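/- Let $d\ge 1$, let $\Omega\subset\mathbb{R}^d$ be a nonempty bounded open set, and let $\lambda_1\le\lambda_2\le\cdots$ be the eigenvalues of the Dirichlet Laplacian $-\Delta$ on $\Omega$, in nondecreasing order and repeated according to multiplicity; that is, the $\lambda_k$ are the real numbers $\mu$ for which there is $0\ne u\in H^1_0(\Omega)$ with $\int_\Omega\nabla u\cdot\nabla v=\mu\int_\Omega uv$ for all $v\in H^1_0(\Omega)$, and such a sequence $(\lambda_k)_{k\ge1}$ exists and satisfies $\lambda_1>0$. For $\sigma>0$ and $z\in\mathbb{R}$ let $$R_\sigma(z):=\sum_{k\ge1}(z-\lambda_k)_+^\sigma,\qquad x_+:=\max(0,x).$$ Then for all real $\sigma\ge 2$ and all $z\ge\left(1+\frac{2\sigma}{d}\right)\lambda_1$ the sum $R_\sigma(z)$ converges and $$\left(\frac{2\sigma}{d}\right)^{\sigma}\lambda_1^{-\frac d2}\left(\frac{z}{1+\frac{2\sigma}{d}}\right)^{\sigma+\frac d2}\;\le\; R_\sigma(z)\;\le\; L^{cl}_{\sigma,d}\,|\Omega|\,z^{\sigma+\frac d2},$$ where $|\Omega|$ is the Lebesgue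 measure of $\Omega$ and $$L^{cl}_{\sigma,d}:=\frac{\Gamma(\sigma+1)}{(4\pi)^{d/2}\,\Gamma\left(\sigma+1+\frac d2\right)}.$$ -/

import Mathlib

open MeasureTheory

noncomputable section

namespace Dirichlet

/-- `C_c^∞(Ω)`: real smooth functions whose support is compact and contained in `Ω`. -/
def IsTestFunction {d : ℕ} (Ω : Set (EuclideanSpace ℝ (Fin d)))
    (φ : EuclideanSpace ℝ (Fin d) → ℝ) : Prop :=
  ContDiff ℝ (⊤ : ℕ∞) φ ∧ HasCompactSupport φ ∧ tsupport φ ⊆ Ω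

/-- Pairs `(φ, ∇φ)` in `L²(Ω) × L²(Ω; ℝ^d)` with `φ ∈ C_c^∞(Ω)`. -/
def testGraph {d : ℕ} (Ω : Set (EuclideanSpace ℝ (Fin d))) :
    Submodule ℝ (Lp ℝ 2 (volume.restrict Ω) ×
      Lp (EuclideanSpace ℝ (Fin d)) 2 (volume.restrict Ω)) where
  carrier := {p | ∃ φ : EuclideanSpace ℝ (Fin d) → ℝ, IsTestFunction Ω φ ∧
    p.1 =ᵐ[volume.restrict Ω] φ ∧ p.2 =ᵐ[volume.restrict Ω] gradient φ}
  zero_mem' := by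
    refine ⟨0, ⟨contDiff_const, HasCompactSupport.zero, by simp [tsupport]⟩,
      Lp.coeFn_zero _ _ _, ?_⟩
    filter_upwards [Lp.coeFn_zero (EuclideanSpace ℝ (Fin d)) 2 (volume.restrict Ω)] with x hx
    simpa [gradient] using hx
  add_mem' := by
    rintro p q ⟨φ, ⟨hφ, hφc, hφs⟩, h1, h2⟩ ⟨ψ, ⟨hψ, hψc, hψs⟩, h3, h4⟩
    refine ⟨φ + ψ, ⟨hφ.add hψ, hφc.add hψc,
      (tsupport_add φ ψ).trans (Set.union_subset hφs hψs)⟩, ?_, ?_⟩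
    · filter_upwards [Lp.coeFn_add p.1 q.1, h1, h3] with x hx h1 h3
      rw [Prod.fst_add, hx, Pi.add_apply, Pi.add_apply, h1, h3]
    · filter_upwards [Lp.coeFn_add p.2 q.2, h2, h4] with x hx h2 h4
      have e := fderiv_add ((hφ.differentiable (by simp)) x) ((hψ.differentiable (by simp)) x)
      rw [Prod.snd_add, hx, Pi.add_apply, h2, h4, gradient, gradient, gradient, e, map_add]
  smul_mem' := by
    rintro c p ⟨φ, ⟨hφ, hφc, hφs⟩, h1, h2⟩
    refine ⟨c • φ, ⟨hφ.const_smul c, hφc.smul_left (f := fun _ => c),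
      (tsupport_smul_subset_right (fun _ => c) φ).trans hφs⟩, ?_, ?_⟩
    · filter_upwards [Lp.coeFn_smul c p.1, h1] with x hx h1
      simp [hx, h1]
    · filter_upwards [Lp.coeFn_smul c p.2, h2] with x hx h2
      have e := fderiv_const_smul ((hφ.differentiable (by simp)) x) c
      simp [hx, h2, gradient, e]

/-- The Sobolev space `H¹₀(Ω)`, as the set of pairs `(u, ∇u)`: the closure of
`C_c^∞(Ω)` in the `H¹` norm. -/
def sobolevH10 {d : ℕ} (Ω : Set (EuclideanSpace ℝ (Fin d))) :
    Submodule ℝ (Lp ℝ 2 (volume.restrict Ω) ×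
      Lp (EuclideanSpace ℝ (Fin d)) 2 (volume.restrict Ω)) :=
  (testGraph Ω).topologicalClosure

/-- The eigenspace of the Dirichlet Laplacian `-Δ` on `Ω` at `μ`: all `u ∈ H¹₀(Ω)` with
`∫_Ω ∇u · ∇v = μ ∫_Ω u v` for every `v ∈ H¹₀(Ω)`. -/
def eigenspace {d : ℕ} (Ω : Set (EuclideanSpace ℝ (Fin d))) (μ : ℝ) :
    Submodule ℝ (Lp ℝ 2 (volume.restrict Ω)) where
  carrier := {u | ∃ g, (u, g) ∈ sobolevH10 Ω ∧
    ∀ q ∈ sobolevH10 Ω, inner ℝ g q.2 = μ * inner ℝ u q.1}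
  zero_mem' := ⟨0, (sobolevH10 Ω).zero_mem, fun q _ => by simp⟩
  add_mem' := by
    rintro u v ⟨g, hg, hu⟩ ⟨h, hh, hv⟩
    refine ⟨g + h, (sobolevH10 Ω).add_mem hg hh, fun q hq => ?_⟩
    rw [inner_add_left, inner_add_left, hu q hq, hv q hq]
    ring
  smul_mem' := by
    rintro c u ⟨g, hg, hu⟩
    refine ⟨c • g, (sobolevH10 Ω).smul_mem c hg, fun q hq => ?_⟩
    rw [real_inner_smul_left, real_inner_smul_left, hu q hq]
    ring

/-- `lam 0 ≤ lam 1 ≤ …` lists the eigenvalues of the Dirichlet Laplacian on `Ω`, each one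
as often as its multiplicity; in the usual numbering from one, `λ_k = lam (k - 1)`. -/
structure IsSpectrum {d : ℕ} (Ω : Set (EuclideanSpace ℝ (Fin d))) (lam : ℕ → ℝ) : Prop where
  monotone : Monotone lam
  multiplicity : ∀ μ : ℝ,
    {k : ℕ | lam k = μ}.encard = Cardinal.toENat (Module.rank ℝ (eigenspace Ω μ))

/-- The terms `(z - λ_k)_+^σ` of the Riesz mean. -/
def rieszTerm (lam : ℕ → ℝ) (σ z : ℝ) (k : ℕ) : ℝ := (max 0 (z - lam k)) ^ σ

/-- The Riesz mean `R_σ(z) = ∑_k (z - λ_k)_+^σ` of order `σ > 0`. -/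
def rieszMean (lam : ℕ → ℝ) (σ z : ℝ) : ℝ := ∑' k, rieszTerm lam σ z k

/-- The classical constant `L^cl_{σ,d}`. -/
def classicalConst (σ : ℝ) (d : ℕ) : ℝ :=
  Real.Gamma (σ + 1) /
    ((4 * Real.pi) ^ ((d : ℝ) / 2) * Real.Gamma (σ + 1 + (d : ℝ) / 2))

end Dirichlet

end

/-!
Write `h t = (z - t)_+^σ`. *Upper bound* (Berezin, Li, Yau): for a normalized eigenfunction `u` with
eigenvalue `λ < z`, Plancherel's theorem says that `|û|² dξ` is a probability measure for which
`4π²|ξ|²` has mean `λ`, so a tangent line of the convex function `h` gives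
`h λ ≤ ∫ h (4π²|ξ|²) |û ξ|² dξ`. Summing over an orthonormal family, Bessel's inequality for the
plane wave of frequency `ξ` bounds `∑ j, |û_j ξ|²` by `|Ω|`.

*Lower bound* (Harrell, Hermi): let `W_kj = ∑ a, ⟨u_k, x_a u_j⟩²`. The commutators
`[-Δ, x_a] = -2 ∂_a` and `[∂_a, x_a] = 1` give the sum rules `∑ k, (λ_k - λ_j) W_kj = d` and
`∑ k, (λ_k - λ_j)² W_kj = 4 λ_j`. Weighting them and using the symmetry of `W` yields
`(d + 2 σ) R_σ ≤ 2 σ z R_{σ-1} = 2 z dR_σ/dz`, so `R_σ(z) z ^ (-σ - d / 2)` is nondecreasing.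
It remains to compare `z` with `(1 + 2 σ / d) λ₁`, where the first term of `R_σ` suffices.

The spectrum is discrete because the tangent line bound makes the form coercive modulo finitely many
plane waves, so `H¹₀(Ω)` embeds compactly into `L²(Ω)`.
-/

noncomputable section

section RealPowers

variable {σ x y z : ℝ}

theorem rpow_add_mul_sub_le_rpow (hσ : 1 ≤ σ) (hx : 0 < x) (hy : 0 ≤ y) :
    x ^ σ + σ * x ^ (σ - 1) * (y - x) ≤ y ^ σ := by
  have hratio : 0 ≤ y / x := div_nonneg hy hx.le
  have hbernoulli : 1 + σ * (y / x - 1) ≤ (y / x) ^ σ := by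
    simpa using one_add_mul_self_le_rpow_one_add (s := y / x - 1) (by linarith) hσ
  calc x ^ σ + σ * x ^ (σ - 1) * (y - x)
      = x ^ σ * (1 + σ * (y / x - 1)) := by rw [Real.rpow_sub_one hx.ne']; field_simp
    _ ≤ x ^ σ * (y / x) ^ σ := by gcongr
    _ = y ^ σ := by rw [← Real.mul_rpow hx.le hratio, mul_div_cancel₀ _ hx.ne']

/-- For `p ≥ 1` the function `t ↦ t ^ p` is convex, so its integral over `[y, x]` is at most the
value of the trapezoidal rule; here `p = σ - 1`. -/
theorem rpow_sub_rpow_le_trapezoid (hσ : 2 ≤ σ) (hy : 0 < y) (hyx : y ≤ x) :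
    x ^ σ - y ^ σ ≤ σ / 2 * (x ^ (σ - 1) + y ^ (σ - 1)) * (x - y) := by
  let gap : ℝ → ℝ := fun t => σ / 2 * (t ^ (σ - 1) + y ^ (σ - 1)) * (t - y) - t ^ σ
  have hderiv : ∀ t, 0 < t → HasDerivAt gap (σ / 2 * ((σ - 1) * t ^ (σ - 1 - 1)) * (t - y) +
      σ / 2 * (t ^ (σ - 1) + y ^ (σ - 1)) * 1 - σ * t ^ (σ - 1)) t := fun t ht =>
    ((((Real.hasDerivAt_rpow_const (.inl ht.ne')).add_const _).const_mul _).mul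
      ((hasDerivAt_id t).sub_const y)).sub (Real.hasDerivAt_rpow_const (.inl ht.ne'))
  have hmono : MonotoneOn gap (Set.Ici y) := by
    refine monotoneOn_of_deriv_nonneg (convex_Ici y)
      (fun t ht => (hderiv t (hy.trans_le ht)).continuousAt.continuousWithinAt)
      (fun t ht => (hderiv t (hy.trans_le (interior_subset ht))).differentiableAt
        |>.differentiableWithinAt) fun t ht => ?_
    have ht : 0 < t := hy.trans_le (interior_subset ht)
    rw [(hderiv t ht).deriv]
    have htangent := rpow_add_mul_sub_le_rpow (σ := σ - 1) (by linarith) ht hy.le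
    nlinarith
  have hgap : gap y ≤ gap x := hmono Set.self_mem_Ici hyx hyx
  simp only [gap, sub_self, mul_zero, zero_sub] at hgap
  linarith

theorem rpow_sub_rpow_mul_sub_le_trapezoid (hσ : 2 ≤ σ) (hx : 0 < x) (hy : 0 < y) :
    (x ^ σ - y ^ σ) * (x - y) ≤ σ / 2 * (x ^ (σ - 1) + y ^ (σ - 1)) * (x - y) ^ 2 := by
  rcases le_total y x with h | h
  · nlinarith [mul_le_mul_of_nonneg_right (rpow_sub_rpow_le_trapezoid hσ hy h) (sub_nonneg.2 h)]
  · nlinarith [mul_le_mul_of_nonneg_right (rpow_sub_rpow_le_trapezoid hσ hx h) (sub_nonneg.2 h)]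

theorem hasDerivAt_max_zero_rpow (hσ : 1 < σ) (x : ℝ) :
    HasDerivAt (fun x => max 0 x ^ σ) (σ * max 0 x ^ (σ - 1)) x := by
  have hleft : ∀ x ≤ 0, HasDerivWithinAt (fun x => max 0 x ^ σ) (σ * max 0 x ^ (σ - 1))
      (Set.Iic 0) x := fun x hx => by
    rw [max_eq_left hx, Real.zero_rpow (by linarith), mul_zero]
    refine (hasDerivWithinAt_const x _ (0 : ℝ)).congr_of_mem (fun t ht => ?_) hx
    rw [max_eq_left ht, Real.zero_rpow (by linarith)]
  have hright : ∀ x ≥ 0, HasDerivWithinAt (fun x => max 0 x ^ σ) (σ * max 0 x ^ (σ - 1))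
      (Set.Ici 0) x := fun x hx => by
    rw [max_eq_right hx]
    exact (Real.hasDerivAt_rpow_const (.inr hσ.le)).hasDerivWithinAt.congr_of_mem
      (fun t ht => by rw [max_eq_right ht]) hx
  rcases lt_trichotomy x 0 with hx | rfl | hx
  · exact (hleft x hx.le).hasDerivAt (Iic_mem_nhds hx)
  · simpa [Set.Iic_union_Ici] using (hleft 0 le_rfl).union (hright 0 le_rfl)
  · exact (hright x hx.le).hasDerivAt (Ici_mem_nhds hx)

theorem mul_div_rpow_le_of_mul_le_mul_deriv {f f' : ℝ → ℝ} {p : ℝ} (hy : 0 < y) (hyz : y ≤ z)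
    (hf : ∀ t ∈ Set.Icc y z, HasDerivAt f (f' t) t)
    (hgrowth : ∀ t ∈ Set.Icc y z, p * f t ≤ t * f' t) : f y * (z / y) ^ p ≤ f z := by
  have hderiv : ∀ t ∈ Set.Icc y z, HasDerivAt (fun t => f t * t ^ (-p))
      (f' t * t ^ (-p) + f t * (-p * t ^ (-p - 1))) t := fun t ht =>
    (hf t ht).mul (Real.hasDerivAt_rpow_const (.inl (hy.trans_le ht.1).ne'))
  have hmono : MonotoneOn (fun t => f t * t ^ (-p)) (Set.Icc y z) := by
    refine monotoneOn_of_deriv_nonneg (convex_Icc y z)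
      (fun t ht => (hderiv t ht).continuousAt.continuousWithinAt)
      (fun t ht => (hderiv t (interior_subset ht)).differentiableAt.differentiableWithinAt)
      fun t ht => ?_
    have ht' := interior_subset ht
    have ht0 : 0 < t := hy.trans_le ht'.1
    have hfactor : f' t * t ^ (-p) + f t * (-p * t ^ (-p - 1)) =
        t ^ (-p) / t * (t * f' t - p * f t) := by
      rw [Real.rpow_sub_one ht0.ne']
      field_simp
      ring
    rw [(hderiv t ht').deriv, hfactor]
    exact mul_nonneg (by positivity) (sub_nonneg.2 (hgrowth t ht'))
  have hyz' : f y * y ^ (-p) ≤ f z * z ^ (-p) := hmono ⟨le_rfl, hyz⟩ ⟨hyz, le_rfl⟩ hyz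
  have hz : 0 < z := hy.trans_le hyz
  rw [Real.rpow_neg hy.le, Real.rpow_neg hz.le, ← div_eq_mul_inv, ← div_eq_mul_inv,
    le_div_iff₀ (by positivity)] at hyz'
  rwa [Real.div_rpow hz.le hy.le, ← mul_div_assoc, ← div_mul_eq_mul_div]

end RealPowers

section EulerIntegrals

theorem integral_Ioo_rpow_mul_one_sub_rpow {a b : ℝ} (ha : 0 < a) (hb : 0 < b) :
    ∫ t in Set.Ioo (0 : ℝ) 1, t ^ (a - 1) * (1 - t) ^ (b - 1) = ProbabilityTheory.beta a b := by
  have hcast : ∀ t ∈ Set.Ioc (0 : ℝ) 1,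
      (t : ℂ) ^ ((a : ℂ) - 1) * (1 - (t : ℂ)) ^ ((b : ℂ) - 1) =
        ((t ^ (a - 1) * (1 - t) ^ (b - 1) : ℝ) : ℂ) := fun t ht => by
    push_cast [Complex.ofReal_cpow ht.1.le, Complex.ofReal_cpow (sub_nonneg.2 ht.2)]
    rfl
  rw [ProbabilityTheory.beta_eq_betaIntegralReal a b ha hb, Complex.betaIntegral,
    intervalIntegral.integral_of_le zero_le_one, setIntegral_congr_fun measurableSet_Ioc hcast,
    integral_complex_ofReal, Complex.ofReal_re, integral_Ioc_eq_integral_Ioo]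

theorem integral_comp_norm_sq {ι : Type*} [Fintype ι] [Nonempty ι] (f : ℝ → ℝ) :
    ∫ ξ : EuclideanSpace ℝ ι, f (‖ξ‖ ^ 2) =
      Real.pi ^ ((Fintype.card ι : ℝ) / 2) / Real.Gamma ((Fintype.card ι : ℝ) / 2) *
        ∫ t in Set.Ioi (0 : ℝ), t ^ ((Fintype.card ι : ℝ) / 2 - 1) * f t := by
  set n := Fintype.card ι with hn
  have hn1 : 1 ≤ n := Fintype.card_pos
  have hn0 : 0 < (n : ℝ) / 2 := by positivity
  have hradial : ∫ r in Set.Ioi (0 : ℝ), r ^ (n - 1) • f (r ^ 2) =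
      1 / 2 * ∫ t in Set.Ioi (0 : ℝ), t ^ ((n : ℝ) / 2 - 1) * f t := by
    rw [← integral_comp_rpow_Ioi (fun t : ℝ => t ^ ((n : ℝ) / 2 - 1) * f t) (two_ne_zero' ℝ),
      ← integral_const_mul]
    refine setIntegral_congr_fun measurableSet_Ioi fun r (hr : 0 < r) => ?_
    have hpow : (r ^ (2 : ℝ)) ^ ((n : ℝ) / 2 - 1) * r = r ^ (n - 1) := by
      rw [← Real.rpow_mul hr.le, ← Real.rpow_add_one hr.ne', ← Real.rpow_natCast,
        Nat.cast_sub hn1]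
      congr 1
      push_cast
      ring
    rw [← hpow, smul_eq_mul, smul_eq_mul, Real.rpow_two, abs_two]
    norm_num
    ring
  have hball : volume.real (Metric.ball (0 : EuclideanSpace ℝ ι) 1) =
      Real.pi ^ ((n : ℝ) / 2) / (n / 2 * Real.Gamma ((n : ℝ) / 2)) := by
    rw [Measure.real, EuclideanSpace.volume_ball, ← hn, Real.Gamma_add_one hn0.ne',
      Real.sqrt_eq_rpow, ← Real.rpow_mul_natCast Real.pi_pos.le, ENNReal.ofReal_one, one_pow,
      one_mul, ENNReal.toReal_ofReal (by positivity), one_div_mul_eq_div]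
  rw [integral_fun_norm_addHaar volume fun r => f (r ^ 2), finrank_euclideanSpace, ← hn, hradial,
    hball, nsmul_eq_mul, smul_eq_mul]
  field_simp

end EulerIntegrals

section FormEigenpair

variable {A B : Type*} [NormedAddCommGroup A] [InnerProductSpace ℝ A] [NormedAddCommGroup B]
  [InnerProductSpace ℝ B] {K : Submodule ℝ (A × B)} {μ ν : ℝ} {p q : A × B}

/-- A form domain is given as the graph `K` of a densely defined operator `u ↦ ∇u` from `A` to `B`.
The pair `(u, ∇u)` belongs to the eigenvalue `μ` of the form `(u, v) ↦ ⟪∇u, ∇v⟫` if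
`⟪∇u, ∇v⟫ = μ ⟪u, v⟫` for all `(v, ∇v)` in `K`. -/
def IsFormEigenpair (K : Submodule ℝ (A × B)) (μ : ℝ) (p : A × B) : Prop :=
  p ∈ K ∧ ∀ q ∈ K, inner ℝ p.2 q.2 = μ * inner ℝ p.1 q.1

theorem IsFormEigenpair.norm_sq_snd (hp : IsFormEigenpair K μ p) : ‖p.2‖ ^ 2 = μ * ‖p.1‖ ^ 2 := by
  simpa only [real_inner_self_eq_norm_sq] using hp.2 p hp.1

theorem IsFormEigenpair.inner_fst_eq_zero (hp : IsFormEigenpair K μ p)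
    (hq : IsFormEigenpair K ν q) (hμν : μ ≠ ν) : inner ℝ p.1 q.1 = 0 := by
  have hpq := hp.2 q hq.1
  rw [real_inner_comm, hq.2 p hp.1, real_inner_comm] at hpq
  exact (mul_eq_mul_right_iff.1 hpq).resolve_left hμν.symm

end FormEigenpair

section CompactOperator

variable {𝕜 E F : Type*} [RCLike 𝕜] [NormedAddCommGroup E] [InnerProductSpace 𝕜 E]
  [NormedAddCommGroup F]

theorem isCompactOperator_of_small_on_finite_codim [NormedSpace 𝕜 F] [CompleteSpace F]
    {T : E →L[𝕜] F}
    (hT : ∀ ε > 0, ∃ s : Set E, s.Finite ∧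
      ∀ x, (∀ y ∈ s, inner 𝕜 y x = 0) → ‖T x‖ ≤ ε * ‖x‖) : IsCompactOperator T := by
  have hclosed := isClosed_setOfPred_isCompactOperator (σ₁₂ := RingHom.id 𝕜) (M₁ := E) (M₂ := F)
  refine hclosed.closure_subset (Metric.mem_closure_iff.2 fun ε hε => ?_)
  obtain ⟨s, hs, hsmall⟩ := hT (ε / 2) (half_pos hε)
  let V := Submodule.span 𝕜 s
  have : FiniteDimensional 𝕜 V := FiniteDimensional.span_of_finite 𝕜 hs
  refine ⟨(T ∘L V.subtypeL) ∘L V.orthogonalProjectionOnto,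
    (isCompactOperator_of_locallyCompactSpace_rng (T ∘L V.subtypeL)).comp_clm _, ?_⟩
  rw [dist_eq_norm]
  refine (ContinuousLinearMap.opNorm_le_bound _ (half_pos hε).le fun x => ?_).trans_lt
    (half_lt_self hε)
  have hmem : Vᗮ.starProjection x ∈ Vᗮ := Submodule.starProjection_apply_mem Vᗮ x
  calc ‖T x - T (V.starProjection x)‖ = ‖T (Vᗮ.starProjection x)‖ := by
        rw [Submodule.starProjection_orthogonal_val, map_sub]
    _ ≤ ε / 2 * ‖Vᗮ.starProjection x‖ :=
      hsmall _ fun y hy => hmem y (Submodule.subset_span hy)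
    _ ≤ ε / 2 * ‖x‖ := by
      gcongr
      exact Submodule.norm_starProjection_apply_le Vᗮ x

theorem isCompactOperator_of_small_of_finite_inner_eq_zero [InnerProductSpace 𝕜 F]
    [CompleteSpace E] [CompleteSpace F] {T : E →L[𝕜] F}
    (hT : ∀ ε > 0, ∃ s : Set F, s.Finite ∧
      ∀ x, (∀ y ∈ s, inner 𝕜 y (T x) = 0) → ‖T x‖ ≤ ε * ‖x‖) : IsCompactOperator T := by
  refine isCompactOperator_of_small_on_finite_codim fun ε hε => ?_
  obtain ⟨s, hs, hsmall⟩ := hT ε hε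
  refine ⟨T.adjoint '' s, hs.image _, fun x hx => hsmall x fun y hy => ?_⟩
  rw [← ContinuousLinearMap.adjoint_inner_left]
  exact hx _ ⟨y, hy, rfl⟩

theorem exists_finite_forall_norm_inner_le_of_isCompact {W : Set E} (hW : IsCompact W)
    {ε : ℝ} (hε : 0 < ε) : ∃ s : Set E, s.Finite ∧ ∀ u, (∀ y ∈ s, inner 𝕜 y u = 0) →
      ∀ w ∈ W, ‖inner 𝕜 w u‖ ≤ ε * ‖u‖ := by
  obtain ⟨s, -, hs, hcover⟩ := hW.finite_cover_balls hε
  refine ⟨s, hs, fun u hu w hw => ?_⟩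
  obtain ⟨y, hy, hwy⟩ := Set.mem_iUnion₂.1 (hcover hw)
  calc ‖inner 𝕜 w u‖ = ‖inner 𝕜 (w - y) u‖ := by rw [inner_sub_left, hu y hy, sub_zero]
    _ ≤ ‖w - y‖ * ‖u‖ := norm_inner_le_norm _ _
    _ ≤ ε * ‖u‖ := by
      gcongr
      exact (mem_ball_iff_norm.1 hwy).le

end CompactOperator

section CoerciveModFinite

variable {A B : Type*} [NormedAddCommGroup A] [InnerProductSpace ℝ A]
  [NormedAddCommGroup B] [InnerProductSpace ℝ B] {K : Submodule ℝ (A × B)}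

/-- The form `‖∇u‖²` on the graph `K` of `u ↦ ∇u` dominates any multiple of `‖u‖²`, once `u` is
orthogonal to finitely many vectors. This is how discreteness of the spectrum is verified. -/
def IsCoerciveModFinite (K : Submodule ℝ (A × B)) : Prop :=
  ∀ c : ℝ, ∃ s : Set A, s.Finite ∧
    ∀ p ∈ K, (∀ y ∈ s, inner ℝ y p.1 = 0) → c * ‖p.1‖ ^ 2 ≤ ‖p.2‖ ^ 2

theorem IsCoerciveModFinite.finiteDimensional (hK : IsCoerciveModFinite K) {c : ℝ}
    {V : Submodule ℝ A} (hV : ∀ u ∈ V, ∃ g, (u, g) ∈ K ∧ ‖g‖ ^ 2 ≤ c * ‖u‖ ^ 2) :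
    FiniteDimensional ℝ V := by
  obtain ⟨s, hs, hcoercive⟩ := hK (c + 1)
  have : Finite s := hs
  let T : V →ₗ[ℝ] (s → ℝ) := LinearMap.pi fun y => innerₛₗ ℝ (y : A) ∘ₗ V.subtype
  refine FiniteDimensional.of_injective T
    (LinearMap.ker_eq_bot.1 (LinearMap.ker_eq_bot'.2 fun u hu => ?_))
  obtain ⟨g, hg, hgu⟩ := hV u u.2
  have horth : ∀ y ∈ s, inner ℝ y (u : A) = 0 := fun y hy => congrFun hu ⟨y, hy⟩
  have hnorm : ‖(u : A)‖ ^ 2 ≤ 0 := by linarith [hcoercive _ hg horth]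
  simpa using hnorm.antisymm (sq_nonneg _)

/-- The graph `K` with the inner product of the Hilbert sum of `A` and `B`, which for a Sobolev
space is the `H¹` inner product. -/
def graphSpace (K : Submodule ℝ (A × B)) : Submodule ℝ (WithLp 2 (A × B)) :=
  K.comap (WithLp.prodContinuousLinearEquiv 2 ℝ A B).toLinearMap

theorem mem_graphSpace {p : WithLp 2 (A × B)} : p ∈ graphSpace K ↔ (p.fst, p.snd) ∈ K := Iff.rfl

/-- The embedding `(u, ∇u) ↦ u` of a form domain into the ambient space. -/
def graphEmbedding (K : Submodule ℝ (A × B)) : graphSpace K →L[ℝ] A :=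
  WithLp.fstL 2 ℝ A B ∘L (graphSpace K).subtypeL

theorem completeSpace_graphSpace [CompleteSpace A] [CompleteSpace B]
    (hK : IsClosed (K : Set (A × B))) : CompleteSpace (graphSpace K) :=
  (hK.preimage (WithLp.prodContinuousLinearEquiv 2 ℝ A B).continuous).completeSpace_coe

variable [CompleteSpace A] [CompleteSpace (graphSpace K)]

theorem IsCoerciveModFinite.isCompactOperator_graphEmbedding (hK : IsCoerciveModFinite K) :
    IsCompactOperator (graphEmbedding K) := by
  refine isCompactOperator_of_small_of_finite_inner_eq_zero fun ε hε => ?_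
  obtain ⟨s, hs, hcoercive⟩ := hK (ε ^ 2)⁻¹
  refine ⟨s, hs, fun p hp => abs_le_of_sq_le_sq' ?_ (by positivity) |>.2⟩
  have hsnd := hcoercive _ (mem_graphSpace.1 p.2) hp
  have hnorm : ‖p‖ ^ 2 = ‖p.1.fst‖ ^ 2 + ‖p.1.snd‖ ^ 2 := WithLp.prod_norm_sq_eq_of_L2 p.1
  rw [inv_mul_le_iff₀ (by positivity)] at hsnd
  calc ‖p.1.fst‖ ^ 2 ≤ ε ^ 2 * ‖p.1.snd‖ ^ 2 := hsnd
    _ ≤ (ε * ‖p‖) ^ 2 := by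
      rw [mul_pow, hnorm]
      gcongr
      exact le_add_of_nonneg_left (sq_nonneg _)

theorem inner_adjoint_graphEmbedding (u : A) {q : A × B} (hq : q ∈ K) :
    inner ℝ ((graphEmbedding K).adjoint u).1.fst q.1 +
      inner ℝ ((graphEmbedding K).adjoint u).1.snd q.2 = inner ℝ u q.1 :=
  ContinuousLinearMap.adjoint_inner_left (graphEmbedding K)
    (⟨WithLp.toLp 2 q, hq⟩ : graphSpace K) u

/-- The operator `E E†` for the embedding `E` is the resolvent of the form at `-1`, hence the shift
between the two eigenvalues. -/
theorem exists_isFormEigenpair_of_graphEmbedding_adjoint {ν : ℝ} (hν : ν ≠ 0) {u : A}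
    (hu : graphEmbedding K ((graphEmbedding K).adjoint u) = ν • u) :
    ∃ g, IsFormEigenpair K (ν⁻¹ - 1) (u, g) := by
  set p := (graphEmbedding K).adjoint u with hp
  have hpu : p.1.fst = ν • u := hu
  refine ⟨ν⁻¹ • p.1.snd, ?_, fun q hq => ?_⟩
  · simpa [hpu, hν] using K.smul_mem ν⁻¹ (mem_graphSpace.1 p.2)
  · have hinner := inner_adjoint_graphEmbedding u hq
    rw [← hp, hpu, real_inner_smul_left, ← eq_sub_iff_add_eq'] at hinner
    rw [real_inner_smul_left, hinner]
    field_simp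

theorem eq_zero_of_graphEmbedding_adjoint_eq_zero
    (hdense : ∀ f : A, (∀ p ∈ K, inner ℝ f p.1 = 0) → f = 0) {u : A}
    (hu : graphEmbedding K ((graphEmbedding K).adjoint u) = 0) : u = 0 := by
  have hadj : (graphEmbedding K).adjoint u = 0 := by
    rw [← inner_self_eq_zero (𝕜 := ℝ), ContinuousLinearMap.adjoint_inner_left, hu,
      inner_zero_right]
  refine hdense u fun q hq => ?_
  simpa [hadj] using (inner_adjoint_graphEmbedding u hq).symm

theorem IsCoerciveModFinite.eq_zero_of_forall_isFormEigenpair (hK : IsCoerciveModFinite K)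
    (hdense : ∀ f : A, (∀ p ∈ K, inner ℝ f p.1 = 0) → f = 0) {f : A}
    (hf : ∀ μ p, IsFormEigenpair K μ p → inner ℝ p.1 f = 0) : f = 0 := by
  let S : A →L[ℝ] A := graphEmbedding K ∘L (graphEmbedding K).adjoint
  have hcompact : IsCompactOperator S := hK.isCompactOperator_graphEmbedding.comp_clm _
  have hsymm : S.IsSymmetric :=
    (ContinuousLinearMap.isPositive_self_comp_adjoint (graphEmbedding K)).isSymmetric
  rw [← Submodule.mem_bot ℝ, ← S.orthogonalComplement_iSup_eigenspaces_eq_bot hcompact hsymm,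
    ← Submodule.iInf_orthogonal, Submodule.mem_iInf]
  intro ν u hu
  have hSu : S u = ν • u := Module.End.mem_eigenspace_iff.1 hu
  rcases eq_or_ne ν 0 with rfl | hν
  · rw [eq_zero_of_graphEmbedding_adjoint_eq_zero hdense (hSu.trans (zero_smul ℝ u)),
      inner_zero_left]
  · obtain ⟨g, hg⟩ := exists_isFormEigenpair_of_graphEmbedding_adjoint hν hSu
    exact hf _ _ hg

end CoerciveModFinite

theorem nontrivial_Lp {α F : Type*} [MeasurableSpace α] [NormedAddCommGroup F] [Nontrivial F]
    (μ : Measure α) [IsFiniteMeasure μ] [NeZero μ] (p : ENNReal) : Nontrivial (Lp F p μ) := by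
  obtain ⟨c, hc⟩ := exists_ne (0 : F)
  refine ⟨Lp.const p μ c, 0, fun hzero => ?_⟩
  have hae := (Lp.coeFn_const p μ c).symm.trans (hzero ▸ Lp.coeFn_zero F p μ)
  obtain ⟨_, hx⟩ := hae.exists
  exact hc hx

section AdaptedBasis

variable {𝕜 H ι κ : Type*} [RCLike 𝕜] [NormedAddCommGroup H] [InnerProductSpace 𝕜 H]

theorem nonempty_fin_finrank_equiv_fiber {V : Submodule 𝕜 H} [FiniteDimensional 𝕜 V] {s : Set ι}
    (hs : s.encard = Cardinal.toENat (Module.rank 𝕜 V)) :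
    Nonempty (Fin (Module.finrank 𝕜 V) ≃ s) := by
  rw [← Module.finrank_eq_rank, Cardinal.toENat_nat] at hs
  have : Finite s := (Set.finite_of_encard_eq_coe hs).to_subtype
  refine ⟨(Finite.equivFinOfCardEq ?_).symm⟩
  rw [Nat.card_coe_set_eq, Set.ncard, hs, ENat.toNat_natCast]

theorem exists_hilbertBasis_mem_of_encard_eq_rank [CompleteSpace H] {V : κ → Submodule 𝕜 H}
    [∀ μ, FiniteDimensional 𝕜 (V μ)]
    (hV : OrthogonalFamily 𝕜 (fun μ => V μ) fun μ => (V μ).subtypeₗᵢ)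
    (htotal : (⨆ μ, V μ)ᗮ = ⊥) {e : ι → κ}
    (he : ∀ μ, {i | e i = μ}.encard = Cardinal.toENat (Module.rank 𝕜 (V μ))) :
    ∃ b : HilbertBasis ι 𝕜 H, ∀ i, b i ∈ V (e i) := by
  have hequiv := fun μ => (nonempty_fin_finrank_equiv_fiber (he μ)).some
  have : ∀ μ, Fintype {i // e i = μ} := fun μ => Fintype.ofEquiv _ (hequiv μ)
  let B : ∀ μ, OrthonormalBasis {i // e i = μ} 𝕜 (V μ) := fun μ =>
    (stdOrthonormalBasis 𝕜 (V μ)).reindex (hequiv μ)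
  let v : ι → H := fun i => B (e i) ⟨i, rfl⟩
  have hv : Orthonormal 𝕜 v :=
    (hV.orthonormal_sigma_orthonormal fun μ => (B μ).orthonormal).comp
      (Equiv.sigmaFiberEquiv e).symm (Equiv.injective _)
  have hspan : (Submodule.span 𝕜 (Set.range v))ᗮ = ⊥ := by
    refine eq_bot_mono (Submodule.orthogonal_le (iSup_le fun μ => ?_)) htotal
    rw [← Submodule.map_subtype_top (V μ), ← (B μ).toBasis.span_eq, OrthonormalBasis.coe_toBasis,
      Submodule.map_span]
    refine Submodule.span_mono ?_
    rintro _ ⟨_, ⟨⟨i, rfl⟩, rfl⟩, rfl⟩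
    exact ⟨i, rfl⟩
  refine ⟨HilbertBasis.mkOfOrthogonalEqBot hv hspan, fun i => ?_⟩
  rw [HilbertBasis.coe_mkOfOrthogonalEqBot]
  exact (B (e i) ⟨i, rfl⟩).2

end AdaptedBasis

section Enumeration

theorem nonempty_orderIso_nat {α : Type*} [LinearOrder α] [Infinite α]
    (hα : ∀ a : α, (Set.Iio a).Finite) : Nonempty (ℕ ≃o α) := by
  have hrank : StrictMono fun a : α => (Set.Iio a).ncard := fun a b hab =>
    Set.ncard_lt_ncard (Set.Iio_ssubset_Iio hab) (hα b)
  have : Infinite (Set.range fun a : α => (Set.Iio a).ncard) :=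
    (Set.infinite_range_of_injective hrank.injective).to_subtype
  classical
  exact ⟨(Nat.Subtype.orderIsoOfNat _).trans hrank.orderIso.symm⟩

theorem exists_linearOrder_monotone {ι α : Type*} [LinearOrder α] (e : ι → α) :
    ∃ _ : LinearOrder ι, Monotone e := by
  classical
  let : LinearOrder ι := linearOrderOfSTO WellOrderingRel
  have hinj : Function.Injective fun i => toLex (e i, i) := fun i j hij =>
    (Prod.ext_iff.1 (toLex.injective hij)).2
  exact ⟨LinearOrder.lift' _ hinj, fun _ _ hij => Prod.Lex.monotone_fst _ _ hij⟩

theorem exists_equiv_nat_monotone_comp {ι α : Type*} [Infinite ι] [LinearOrder α] {e : ι → α}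
    (he : ∀ a, {i | e i ≤ a}.Finite) : ∃ f : ℕ ≃ ι, Monotone (e ∘ f) := by
  obtain ⟨_, hmono⟩ := exists_linearOrder_monotone e
  obtain ⟨f⟩ := nonempty_orderIso_nat fun i : ι =>
    (he (e i)).subset fun j (hj : j < i) => hmono hj.le
  exact ⟨f.toEquiv, hmono.comp f.monotone⟩

end Enumeration

namespace Dirichlet

section RieszFunction

variable {σ z s t : ℝ}

/-- The function `t ↦ (z - t)_+^σ`, whose values at the eigenvalues are the terms of the Riesz
mean of order `σ`. -/
def rieszFun (σ z t : ℝ) : ℝ := max 0 (z - t) ^ σ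

theorem rieszFun_nonneg (σ z t : ℝ) : 0 ≤ rieszFun σ z t :=
  Real.rpow_nonneg (le_max_left _ _) _

theorem rieszFun_of_lt (ht : t < z) : rieszFun σ z t = (z - t) ^ σ := by
  rw [rieszFun, max_eq_right (sub_pos.2 ht).le]

theorem rieszFun_of_le (hσ : 0 < σ) (ht : z ≤ t) : rieszFun σ z t = 0 := by
  rw [rieszFun, max_eq_left (sub_nonpos.2 ht), Real.zero_rpow hσ.ne']

theorem continuous_rieszFun (hσ : 0 ≤ σ) (z : ℝ) : Continuous (rieszFun σ z) :=
  Continuous.rpow_const (by fun_prop) fun _ => .inr hσ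

theorem rieszFun_eq_sub_mul (hσ : 1 < σ) (z t : ℝ) :
    rieszFun σ z t = (z - t) * rieszFun (σ - 1) z t := by
  rcases lt_or_ge t z with h | h
  · have hzt : 0 < z - t := sub_pos.2 h
    rw [rieszFun_of_lt h, rieszFun_of_lt h, Real.rpow_sub_one hzt.ne', mul_div_cancel₀ _ hzt.ne']
  · rw [rieszFun_of_le (by linarith) h, rieszFun_of_le (by linarith) h, mul_zero]

theorem rieszFun_sub_mul_le (hσ : 1 ≤ σ) (hs : s < z) (t : ℝ) :
    rieszFun σ z s - σ * (z - s) ^ (σ - 1) * (t - s) ≤ rieszFun σ z t := by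
  have hzs : 0 < z - s := sub_pos.2 hs
  have htangent := rpow_add_mul_sub_le_rpow hσ hzs (le_max_left 0 (z - t))
  have hslope : 0 ≤ σ * (z - s) ^ (σ - 1) := by positivity
  rw [rieszFun_of_lt hs]
  refine le_trans ?_ htangent
  nlinarith [le_max_right 0 (z - t)]

theorem hasDerivAt_rieszFun (hσ : 1 < σ) (z t : ℝ) :
    HasDerivAt (fun z => rieszFun σ z t) (σ * rieszFun (σ - 1) z t) z :=
  (hasDerivAt_max_zero_rpow hσ (z - t)).comp_sub_const z t

theorem rieszFun_mul (hz : 0 ≤ z) (σ t : ℝ) : rieszFun σ z (z * t) = z ^ σ * rieszFun σ 1 t := by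
  rw [rieszFun, rieszFun, ← Real.mul_rpow hz (le_max_left _ _), mul_max_of_nonneg _ _ hz, mul_zero,
    mul_one_sub]

theorem integral_rpow_mul_rieszFun_one {a : ℝ} (ha : 0 < a) (hσ : 0 < σ) :
    ∫ t in Set.Ioi (0 : ℝ), t ^ (a - 1) * rieszFun σ 1 t = ProbabilityTheory.beta a (σ + 1) := by
  rw [← integral_Ioo_rpow_mul_one_sub_rpow ha (by linarith : 0 < σ + 1),
    setIntegral_eq_of_subset_of_forall_sdiff_eq_zero measurableSet_Ioi Set.Ioo_subset_Ioi_self]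
  · refine setIntegral_congr_fun measurableSet_Ioo fun t ht => ?_
    rw [rieszFun_of_lt ht.2, add_sub_cancel_right]
  · rintro t ⟨ht0, ht1⟩
    rw [rieszFun_of_le hσ (not_lt.1 fun h => ht1 ⟨ht0, h⟩), mul_zero]

theorem integral_rpow_mul_rieszFun {a c : ℝ} (ha : 0 < a) (hσ : 0 < σ) (hz : 0 < z) (hc : 0 < c) :
    ∫ t in Set.Ioi (0 : ℝ), t ^ (a - 1) * rieszFun σ z (c * t) =
      (z / c) ^ a * z ^ σ * ProbabilityTheory.beta a (σ + 1) := by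
  have hzc : 0 < z / c := div_pos hz hc
  have hscale := integral_comp_mul_left_Ioi (fun t => t ^ (a - 1) * rieszFun σ z (c * t)) 0 hzc
  rw [mul_zero, smul_eq_mul, eq_comm, inv_mul_eq_iff_eq_mul₀ hzc.ne'] at hscale
  rw [hscale, ← integral_rpow_mul_rieszFun_one ha hσ, ← integral_const_mul, ← integral_const_mul]
  refine setIntegral_congr_fun measurableSet_Ioi fun t (ht : 0 < t) => ?_
  have harg : c * (z / c * t) = z * t := by field_simp
  simp only [harg, rieszFun_mul hz.le]
  rw [Real.mul_rpow hzc.le ht.le, Real.rpow_sub_one hzc.ne']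
  field_simp

end RieszFunction

/-- The symbol `4π²|ξ|²` of `-Δ` for the Fourier transform with kernel `exp (-2πi x·ξ)`. -/
def laplaceSymbol {E : Type*} [Norm E] (ξ : E) : ℝ := 4 * Real.pi ^ 2 * ‖ξ‖ ^ 2

theorem integral_rieszFun_laplaceSymbol {d : ℕ} (hd : 1 ≤ d) {σ z : ℝ} (hσ : 0 < σ) (hz : 0 < z) :
    ∫ ξ : EuclideanSpace ℝ (Fin d), rieszFun σ z (laplaceSymbol ξ) =
      classicalConst σ d * z ^ (σ + (d : ℝ) / 2) := by
  have : Nonempty (Fin d) := ⟨⟨0, hd⟩⟩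
  have ha : 0 < (d : ℝ) / 2 := by positivity
  have hfour : (4 * Real.pi ^ 2) ^ ((d : ℝ) / 2) =
      (4 * Real.pi) ^ ((d : ℝ) / 2) * Real.pi ^ ((d : ℝ) / 2) := by
    rw [← Real.mul_rpow (by positivity) Real.pi_pos.le]
    congr 1
    ring
  simp only [laplaceSymbol]
  rw [integral_comp_norm_sq fun t => rieszFun σ z (4 * Real.pi ^ 2 * t), Fintype.card_fin,
    integral_rpow_mul_rieszFun ha hσ hz (by positivity), classicalConst, ProbabilityTheory.beta,
    Real.rpow_add hz, Real.div_rpow hz.le (by positivity), hfour,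
    show (d : ℝ) / 2 + (σ + 1) = σ + 1 + d / 2 by ring]
  have hGamma : Real.Gamma ((d : ℝ) / 2) ≠ 0 := (Real.Gamma_pos_of_pos ha).ne'
  field_simp

section YangWeight

variable {σ z s t : ℝ}

/-- The coefficient of `W k j` in the Yang-type inequality for `s = e j` and `t = e k`, obtained by
weighting the two sum rules at `j` with `σ / 2 * (z - s)_+^(σ - 1)` and `(z - s)_+^σ`. -/
def yangWeight (σ z s t : ℝ) : ℝ :=
  σ / 2 * rieszFun (σ - 1) z s * (t - s) ^ 2 - rieszFun σ z s * (t - s)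

theorem yangWeight_of_le (hσ : 1 < σ) (hs : z ≤ s) : yangWeight σ z s t = 0 := by
  rw [yangWeight, rieszFun_of_le (by linarith) hs, rieszFun_of_le (by linarith) hs]
  ring

theorem yangWeight_nonneg_of_le (hσ : 2 ≤ σ) (ht : z ≤ t) : 0 ≤ yangWeight σ z s t := by
  rcases lt_or_ge s z with hs | hs
  · have hfactor : yangWeight σ z s t =
        rieszFun (σ - 1) z s * (t - s) * (σ / 2 * (t - s) - (z - s)) := by
      rw [yangWeight, rieszFun_eq_sub_mul (σ := σ) (by linarith) z s]
      ring
    have hlast : 0 ≤ σ / 2 * (t - s) - (z - s) := by nlinarith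
    rw [hfactor]
    exact mul_nonneg (mul_nonneg (rieszFun_nonneg _ _ _) (by linarith)) hlast
  · exact (yangWeight_of_le (by linarith) hs).ge

theorem yangWeight_add_swap_nonneg (hσ : 2 ≤ σ) :
    0 ≤ yangWeight σ z s t + yangWeight σ z t s := by
  rcases le_or_gt z t with ht | ht
  · rw [yangWeight_of_le (by linarith) ht, add_zero]
    exact yangWeight_nonneg_of_le hσ ht
  rcases le_or_gt z s with hs | hs
  · rw [yangWeight_of_le (by linarith) hs, zero_add]
    exact yangWeight_nonneg_of_le hσ hs
  · have htrapezoid := rpow_sub_rpow_mul_sub_le_trapezoid hσ (sub_pos.2 hs) (sub_pos.2 ht)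
    rw [yangWeight, yangWeight, rieszFun_of_lt hs, rieszFun_of_lt hs, rieszFun_of_lt ht,
      rieszFun_of_lt ht]
    linarith

end YangWeight

section SumRules

variable {ι : Type*} {e : ι → ℝ} {W : ι → ι → ℝ} {D : ℝ}

/-- The two sum rules for energies `e` and transition strengths `W`. For the position operators on
a domain of dimension `D` they are the Thomas–Reiche–Kuhn sum rule and its second-order analogue. -/
structure SumRules (e : ι → ℝ) (W : ι → ι → ℝ) (D : ℝ) : Prop where
  symm : ∀ j k, W j k = W k j
  nonneg : ∀ j k, 0 ≤ W j k
  hasSum_sub_mul : ∀ j, HasSum (fun k => (e k - e j) * W k j) D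
  hasSum_sub_sq_mul : ∀ j, HasSum (fun k => (e k - e j) ^ 2 * W k j) (4 * e j)

namespace SumRules

theorem infinite [Nonempty ι] (h : SumRules e W D) (hD : D ≠ 0) : Infinite ι := by
  refine not_finite_iff_infinite.1 fun _ => hD ?_
  have := Fintype.ofFinite ι
  have hsum : ∑ j, ∑ k, (e k - e j) * W k j = Fintype.card ι * D := by
    simp_rw [fun j => (hasSum_fintype _).unique (h.hasSum_sub_mul j)]
    simp
  have hanti : ∑ j, ∑ k, (e k - e j) * W k j = -∑ j, ∑ k, (e k - e j) * W k j := by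
    conv_lhs => rw [Finset.sum_comm]
    simp_rw [← Finset.sum_neg_distrib, ← neg_mul, neg_sub, h.symm]
  have hcard : (Fintype.card ι : ℝ) * D = 0 := by linarith
  exact (mul_eq_zero.1 hcard).resolve_left (Nat.cast_ne_zero.2 Fintype.card_ne_zero)

variable {σ z : ℝ} {J : Finset ι}

theorem sum_yangWeight_mul_nonneg (h : SumRules e W D) (hσ : 2 ≤ σ) :
    0 ≤ ∑ k ∈ J, ∑ j ∈ J, yangWeight σ z (e j) (e k) * W k j := by
  have hpairs : 0 ≤ ∑ k ∈ J, ∑ j ∈ J,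
      (yangWeight σ z (e j) (e k) * W k j + yangWeight σ z (e k) (e j) * W j k) :=
    Finset.sum_nonneg fun k _ => Finset.sum_nonneg fun j _ => by
      rw [h.symm j k, ← add_mul]
      exact mul_nonneg (yangWeight_add_swap_nonneg hσ) (h.nonneg k j)
  simp_rw [Finset.sum_add_distrib] at hpairs
  rw [Finset.sum_comm (f := fun k j => yangWeight σ z (e k) (e j) * W j k)] at hpairs
  linarith

theorem mul_sum_rieszFun_le (h : SumRules e W D) (hσ : 2 ≤ σ) (hJ : ∀ i, e i < z → i ∈ J) :
    D * ∑ j ∈ J, rieszFun σ z (e j) ≤ 2 * σ * ∑ j ∈ J, rieszFun (σ - 1) z (e j) * e j := by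
  have hsum : HasSum (fun k => ∑ j ∈ J, yangWeight σ z (e j) (e k) * W k j)
      (∑ j ∈ J, (σ / 2 * rieszFun (σ - 1) z (e j) * (4 * e j) - rieszFun σ z (e j) * D)) := by
    refine hasSum_sum fun j _ => ?_
    simp_rw [yangWeight, sub_mul, mul_assoc _ (e _ - e j), mul_assoc _ ((e _ - e j) ^ 2)]
    exact ((h.hasSum_sub_sq_mul j).mul_left _).sub ((h.hasSum_sub_mul j).mul_left _)
  have houter : ∀ k ∉ J, 0 ≤ ∑ j ∈ J, yangWeight σ z (e j) (e k) * W k j := fun k hk =>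
    Finset.sum_nonneg fun j _ =>
      mul_nonneg (yangWeight_nonneg_of_le hσ (not_lt.1 (mt (hJ k) hk))) (h.nonneg k j)
  have hnonneg := (h.sum_yangWeight_mul_nonneg hσ).trans (sum_le_hasSum J houter hsum)
  rw [Finset.sum_sub_distrib, ← Finset.sum_mul] at hnonneg
  have hfactor : ∑ j ∈ J, σ / 2 * rieszFun (σ - 1) z (e j) * (4 * e j) =
      2 * σ * ∑ j ∈ J, rieszFun (σ - 1) z (e j) * e j := by
    rw [Finset.mul_sum]
    exact Finset.sum_congr rfl fun j _ => by ring
  linarith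

theorem add_mul_sum_rieszFun_le (h : SumRules e W D) (hσ : 2 ≤ σ) (hJ : ∀ i, e i < z → i ∈ J) :
    (D + 2 * σ) * ∑ j ∈ J, rieszFun σ z (e j) ≤
      2 * σ * z * ∑ j ∈ J, rieszFun (σ - 1) z (e j) := by
  have hsplit : ∑ j ∈ J, rieszFun (σ - 1) z (e j) * e j =
      z * ∑ j ∈ J, rieszFun (σ - 1) z (e j) - ∑ j ∈ J, rieszFun σ z (e j) := by
    rw [Finset.mul_sum, ← Finset.sum_sub_distrib]
    refine Finset.sum_congr rfl fun j _ => ?_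
    rw [rieszFun_eq_sub_mul (σ := σ) (by linarith) z (e j)]
    ring
  linarith [hsplit ▸ h.mul_sum_rieszFun_le hσ hJ]

/-- The Yang-type inequality reads `(σ + D / 2) R ≤ t dR/dt` for the Riesz mean `R` at `t`. -/
theorem sum_rieszFun_mul_div_rpow_le (h : SumRules e W D) (hσ : 2 ≤ σ)
    (hJ : ∀ i, e i < z → i ∈ J) {y : ℝ} (hy : 0 < y) (hyz : y ≤ z) :
    (∑ j ∈ J, rieszFun σ y (e j)) * (z / y) ^ (σ + D / 2) ≤ ∑ j ∈ J, rieszFun σ z (e j) := by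
  refine mul_div_rpow_le_of_mul_le_mul_deriv
    (f' := fun t => ∑ j ∈ J, σ * rieszFun (σ - 1) t (e j)) hy hyz
    (fun t _ => HasDerivAt.fun_sum fun j _ => hasDerivAt_rieszFun (by linarith) t (e j))
    fun t ht => ?_
  rw [← Finset.mul_sum]
  linarith [h.add_mul_sum_rieszFun_le hσ fun i hi => hJ i (hi.trans_le ht.2)]

end SumRules

end SumRules

section VectorField

variable {α : Type*} [MeasurableSpace α] {μ : Measure α}

theorem inner_eq_integral_mul {u v : Lp ℝ 2 μ} {f g : α → ℝ} (hu : u =ᵐ[μ] f) (hv : v =ᵐ[μ] g) :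
    inner ℝ u v = ∫ x, f x * g x ∂μ := by
  rw [L2.inner_def]
  refine integral_congr_ae ?_
  filter_upwards [hu, hv] with x hux hvx
  rw [hux, hvx, RCLike.inner_apply', conj_trivial]

/-- Multiplication by an essentially bounded real function, as an operator on `L²(μ; F)`. -/
def mulOp (F : Type*) [NormedAddCommGroup F] [NormedSpace ℝ F] (f : Lp ℝ ⊤ μ) :
    Lp F 2 μ →L[ℝ] Lp F 2 μ :=
  (ContinuousLinearMap.lsmul ℝ ℝ : ℝ →L[ℝ] F →L[ℝ] F).holderL μ ⊤ 2 2 f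

theorem coeFn_mulOp {F : Type*} [NormedAddCommGroup F] [NormedSpace ℝ F] (f : Lp ℝ ⊤ μ)
    (u : Lp F 2 μ) : mulOp F f u =ᵐ[μ] fun x => f x • u x :=
  ContinuousLinearMap.coeFn_holder (r := 2) (ContinuousLinearMap.lsmul ℝ ℝ) f u

theorem inner_mulOp_left {F : Type*} [NormedAddCommGroup F] [InnerProductSpace ℝ F]
    (f : Lp ℝ ⊤ μ) (u v : Lp F 2 μ) : inner ℝ (mulOp F f u) v = inner ℝ u (mulOp F f v) := by
  rw [L2.inner_def, L2.inner_def]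
  refine integral_congr_ae ?_
  filter_upwards [coeFn_mulOp f u, coeFn_mulOp f v] with x hu hv
  rw [hu, hv, real_inner_smul_left, real_inner_smul_right]

variable {ι : Type*} [Fintype ι]

/-- The `a`-th component of a square-integrable vector field. -/
def component (μ : Measure α) (a : ι) : Lp (EuclideanSpace ℝ ι) 2 μ →L[ℝ] Lp ℝ 2 μ :=
  (EuclideanSpace.proj a : EuclideanSpace ℝ ι →L[ℝ] ℝ).compLpL 2 μ

theorem coeFn_component (a : ι) (g : Lp (EuclideanSpace ℝ ι) 2 μ) :
    component μ a g =ᵐ[μ] fun x => g x a :=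
  ContinuousLinearMap.coeFn_compLpL _ _

theorem component_mulOp (a : ι) (f : Lp ℝ ⊤ μ) (g : Lp (EuclideanSpace ℝ ι) 2 μ) :
    component μ a (mulOp _ f g) = mulOp ℝ f (component μ a g) := by
  refine Lp.ext ?_
  filter_upwards [coeFn_mulOp f g, coeFn_mulOp f (component μ a g), coeFn_component a g,
    coeFn_component a (mulOp _ f g)] with x h₁ h₂ h₃ h₄
  rw [h₄, h₁, h₂, h₃, PiLp.smul_apply]

theorem inner_eq_sum_inner_component (g h : Lp (EuclideanSpace ℝ ι) 2 μ) :
    inner ℝ g h = ∑ a, inner ℝ (component μ a g) (component μ a h) := by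
  simp_rw [L2.inner_def]
  rw [← integral_finsetSum _ fun a _ => L2.integrable_inner _ _]
  refine integral_congr_ae ?_
  filter_upwards [Filter.eventually_all.2 fun a => coeFn_component a g,
    Filter.eventually_all.2 fun a => coeFn_component a h] with x hg hh
  simp only [PiLp.inner_apply, hg, hh]

theorem norm_sq_eq_sum_norm_sq_component (g : Lp (EuclideanSpace ℝ ι) 2 μ) :
    ‖g‖ ^ 2 = ∑ a, ‖component μ a g‖ ^ 2 := by
  simp_rw [← real_inner_self_eq_norm_sq]
  exact inner_eq_sum_inner_component g g

variable [DecidableEq ι]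

/-- The vector field `u e_a`, where `e_a` is the `a`-th standard basis vector. -/
def axisField (μ : Measure α) (a : ι) : Lp ℝ 2 μ →L[ℝ] Lp (EuclideanSpace ℝ ι) 2 μ :=
  ((ContinuousLinearMap.id ℝ ℝ).smulRight (EuclideanSpace.single a (1 : ℝ))).compLpL 2 μ

theorem coeFn_axisField (a : ι) (u : Lp ℝ 2 μ) :
    axisField μ a u =ᵐ[μ] fun x => u x • EuclideanSpace.single a (1 : ℝ) :=
  ContinuousLinearMap.coeFn_compLpL _ _

theorem inner_axisField_right (a : ι) (g : Lp (EuclideanSpace ℝ ι) 2 μ) (u : Lp ℝ 2 μ) :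
    inner ℝ g (axisField μ a u) = inner ℝ (component μ a g) u := by
  rw [L2.inner_def, L2.inner_def]
  refine integral_congr_ae ?_
  filter_upwards [coeFn_component a g, coeFn_axisField a u] with x hg hu
  simp [hg, hu, real_inner_smul_right, EuclideanSpace.inner_single_right]

theorem component_axisField (a : ι) (u : Lp ℝ 2 μ) : component μ a (axisField μ a u) = u := by
  refine Lp.ext ?_
  filter_upwards [coeFn_axisField a u, coeFn_component a (axisField μ a u)] with x hu hc
  simp [hc, hu]

end VectorField

variable {d : ℕ} {Ω : Set (EuclideanSpace ℝ (Fin d))}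

theorem memLp_top_coord (hb : Bornology.IsBounded Ω) (a : Fin d) :
    MemLp (fun x : EuclideanSpace ℝ (Fin d) => x a) ⊤ (volume.restrict Ω) := by
  obtain ⟨R, hR⟩ := hb.exists_norm_le
  have hmeas : MeasurableSet {x : EuclideanSpace ℝ (Fin d) | ‖x a‖ ≤ R} :=
    measurableSet_le (by fun_prop) measurable_const
  exact memLp_top_of_bound (by fun_prop) R <| (ae_restrict_iff hmeas).2 <|
    ae_of_all _ fun x hx => (PiLp.norm_apply_le x a).trans (hR x hx)

/-- The coordinate function `x_a` on a bounded set, as an element of `L^∞(Ω)`. -/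
def coord (hb : Bornology.IsBounded Ω) (a : Fin d) : Lp ℝ ⊤ (volume.restrict Ω) :=
  (memLp_top_coord hb a).toLp

theorem coeFn_coord (hb : Bornology.IsBounded Ω) (a : Fin d) :
    coord hb a =ᵐ[volume.restrict Ω] fun x => x a :=
  (memLp_top_coord hb a).coeFn_toLp

section TestFunction

variable {φ ψ : EuclideanSpace ℝ (Fin d) → ℝ}

theorem gradient_apply (φ : EuclideanSpace ℝ (Fin d) → ℝ) (x : EuclideanSpace ℝ (Fin d))
    (a : Fin d) : gradient φ x a = fderiv ℝ φ x (EuclideanSpace.single a 1) := by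
  rw [← InnerProductSpace.toDual_symm_apply, ← gradient, EuclideanSpace.inner_single_right]
  simp

namespace IsTestFunction

theorem continuous (hφ : IsTestFunction Ω φ) : Continuous φ := hφ.1.continuous

theorem differentiable (hφ : IsTestFunction Ω φ) : Differentiable ℝ φ :=
  hφ.1.differentiable (by simp)

theorem continuous_gradient (hφ : IsTestFunction Ω φ) : Continuous (gradient φ) :=
  (InnerProductSpace.toDual ℝ _).symm.continuous.comp (hφ.1.continuous_fderiv (by simp))

theorem continuous_gradient_apply (hφ : IsTestFunction Ω φ) (a : Fin d) :
    Continuous fun x => gradient φ x a :=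
  (EuclideanSpace.proj a : EuclideanSpace ℝ (Fin d) →L[ℝ] ℝ).continuous.comp
    hφ.continuous_gradient

theorem hasCompactSupport_gradient (hφ : IsTestFunction Ω φ) : HasCompactSupport (gradient φ) :=
  (hφ.2.1.fderiv ℝ).comp_left (g := (InnerProductSpace.toDual ℝ _).symm) (map_zero _)

theorem memLp (hφ : IsTestFunction Ω φ) (μ : Measure (EuclideanSpace ℝ (Fin d)))
    [IsFiniteMeasureOnCompacts μ] : MemLp φ 2 μ :=
  hφ.continuous.memLp_of_hasCompactSupport hφ.2.1

theorem memLp_gradient (hφ : IsTestFunction Ω φ) (μ : Measure (EuclideanSpace ℝ (Fin d)))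
    [IsFiniteMeasureOnCompacts μ] : MemLp (gradient φ) 2 μ :=
  hφ.continuous_gradient.memLp_of_hasCompactSupport hφ.hasCompactSupport_gradient

/-- The pair `(φ, ∇φ)` as an element of `L²(Ω) × L²(Ω; ℝ^d)`. -/
def toPair (hφ : IsTestFunction Ω φ) :
    Lp ℝ 2 (volume.restrict Ω) × Lp (EuclideanSpace ℝ (Fin d)) 2 (volume.restrict Ω) :=
  ((hφ.memLp _).toLp, (hφ.memLp_gradient _).toLp)

theorem coeFn_toPair_fst (hφ : IsTestFunction Ω φ) : hφ.toPair.1 =ᵐ[volume.restrict Ω] φ :=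
  (hφ.memLp _).coeFn_toLp

theorem coeFn_toPair_snd (hφ : IsTestFunction Ω φ) :
    hφ.toPair.2 =ᵐ[volume.restrict Ω] gradient φ :=
  (hφ.memLp_gradient _).coeFn_toLp

theorem component_toPair_snd (hφ : IsTestFunction Ω φ) (a : Fin d) :
    component _ a hφ.toPair.2 =ᵐ[volume.restrict Ω] fun x => gradient φ x a := by
  filter_upwards [coeFn_component a hφ.toPair.2, hφ.coeFn_toPair_snd] with x h₁ h₂
  rw [h₁, h₂]

theorem toPair_mem_sobolevH10 (hφ : IsTestFunction Ω φ) : hφ.toPair ∈ sobolevH10 Ω :=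
  Submodule.le_topologicalClosure _ ⟨φ, hφ, hφ.coeFn_toPair_fst, hφ.coeFn_toPair_snd⟩

theorem eq_zero_of_notMem (hφ : IsTestFunction Ω φ) {x : EuclideanSpace ℝ (Fin d)} (hx : x ∉ Ω) :
    φ x = 0 :=
  image_eq_zero_of_notMem_tsupport fun h => hx (hφ.2.2 h)

theorem gradient_eq_zero_of_notMem (hφ : IsTestFunction Ω φ) {x : EuclideanSpace ℝ (Fin d)}
    (hx : x ∉ Ω) : gradient φ x = 0 := by
  have hfderiv : fderiv ℝ φ x = 0 :=
    image_eq_zero_of_notMem_tsupport fun h => hx (hφ.2.2 (tsupport_fderiv_subset ℝ h))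
  rw [gradient, hfderiv, map_zero]

theorem coord_mul (hφ : IsTestFunction Ω φ) (a : Fin d) :
    IsTestFunction Ω (fun x => x a * φ x) :=
  ⟨ContDiff.mul (by fun_prop) hφ.1, hφ.2.1.mul_left,
    (tsupport_mul_subset_right (f := fun x : EuclideanSpace ℝ (Fin d) => x a)).trans hφ.2.2⟩

theorem gradient_coord_mul (hφ : IsTestFunction Ω φ) (a : Fin d) (x : EuclideanSpace ℝ (Fin d)) :
    gradient (fun x => x a * φ x) x =
      x a • gradient φ x + φ x • EuclideanSpace.single a (1 : ℝ) := by
  have hcoord : HasFDerivAt (fun x : EuclideanSpace ℝ (Fin d) => x a)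
      (EuclideanSpace.proj a : EuclideanSpace ℝ (Fin d) →L[ℝ] ℝ) x :=
    (EuclideanSpace.proj a : EuclideanSpace ℝ (Fin d) →L[ℝ] ℝ).hasFDerivAt
  ext b
  rw [gradient_apply, (hcoord.fun_mul (hφ.differentiable x).hasFDerivAt).fderiv]
  simp [gradient_apply, eq_comm]

theorem integral_gradient_apply_mul (hφ : IsTestFunction Ω φ) (hψ : IsTestFunction Ω ψ)
    (a : Fin d) : ∫ x, gradient φ x a * ψ x = -∫ x, φ x * gradient ψ x a := by
  have h₁ : Integrable fun x => gradient φ x a * ψ x :=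
    ((hφ.continuous_gradient_apply a).mul hψ.continuous).integrable_of_hasCompactSupport
      hψ.2.1.mul_left
  have h₂ : Integrable fun x => φ x * gradient ψ x a :=
    (hφ.continuous.mul (hψ.continuous_gradient_apply a)).integrable_of_hasCompactSupport
      hφ.2.1.mul_right
  have h₃ : Integrable fun x => φ x * ψ x :=
    (hφ.continuous.mul hψ.continuous).integrable_of_hasCompactSupport hφ.2.1.mul_right
  simp only [gradient_apply] at h₁ h₂ ⊢
  rw [integral_mul_fderiv_eq_neg_fderiv_mul_of_integrable h₁ h₂ h₃
    (fun x _ => hφ.differentiable x) (fun x _ => hψ.differentiable x), neg_neg]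

end IsTestFunction

end TestFunction

section Sobolev

variable {p q : Lp ℝ 2 (volume.restrict Ω) ×
  Lp (EuclideanSpace ℝ (Fin d)) 2 (volume.restrict Ω)}

theorem sobolevH10_induction
    {P : Lp ℝ 2 (volume.restrict Ω) × Lp (EuclideanSpace ℝ (Fin d)) 2 (volume.restrict Ω) → Prop}
    (hclosed : IsClosed {p | P p}) (htest : ∀ φ (hφ : IsTestFunction Ω φ), P hφ.toPair)
    (hp : p ∈ sobolevH10 Ω) : P p := by
  refine closure_minimal (t := {p | P p}) ?_ hclosed hp
  rintro q ⟨φ, hφ, h₁, h₂⟩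
  have hq : q = hφ.toPair := Prod.ext (Lp.ext (h₁.trans hφ.coeFn_toPair_fst.symm))
    (Lp.ext (h₂.trans hφ.coeFn_toPair_snd.symm))
  exact hq ▸ htest φ hφ

theorem mulOp_coord_mem_sobolevH10 (hb : Bornology.IsBounded Ω) (a : Fin d)
    (hp : p ∈ sobolevH10 Ω) :
    (mulOp ℝ (coord hb a) p.1, mulOp _ (coord hb a) p.2 + axisField _ a p.1) ∈
      sobolevH10 Ω := by
  refine sobolevH10_induction (P := fun p => (mulOp ℝ (coord hb a) p.1,
    mulOp _ (coord hb a) p.2 + axisField _ a p.1) ∈ sobolevH10 Ω) ?_ (fun φ hφ => ?_) hp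
  · exact (Submodule.isClosed_topologicalClosure (testGraph Ω)).preimage <|
      ((mulOp ℝ (coord hb a)).continuous.comp continuous_fst).prodMk <|
        ((mulOp _ (coord hb a)).continuous.comp continuous_snd).add <|
          (axisField _ a).continuous.comp continuous_fst
  · refine Submodule.le_topologicalClosure _ ⟨_, hφ.coord_mul a, ?_, ?_⟩
    · filter_upwards [coeFn_mulOp (coord hb a) hφ.toPair.1, coeFn_coord hb a,
        hφ.coeFn_toPair_fst] with x h₁ h₂ h₃
      rw [h₁, h₂, h₃, smul_eq_mul]
    · filter_upwards [coeFn_mulOp (coord hb a) hφ.toPair.2, coeFn_coord hb a,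
        hφ.coeFn_toPair_fst, hφ.coeFn_toPair_snd, coeFn_axisField a hφ.toPair.1,
        Lp.coeFn_add (mulOp _ (coord hb a) hφ.toPair.2) (axisField _ a hφ.toPair.1)]
        with x h₁ h₂ h₃ h₄ h₅ h₆
      rw [h₆, Pi.add_apply, h₁, h₂, h₄, h₅, h₃, hφ.gradient_coord_mul a x]

theorem inner_component_eq_neg_inner_component (hp : p ∈ sobolevH10 Ω) (hq : q ∈ sobolevH10 Ω)
    (a : Fin d) : inner ℝ (component _ a p.2) q.1 = -inner ℝ p.1 (component _ a q.2) := by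
  refine sobolevH10_induction (P := fun p => inner ℝ (component _ a p.2) q.1 =
    -inner ℝ p.1 (component _ a q.2)) (isClosed_eq (by fun_prop) (by fun_prop))
    (fun φ hφ => ?_) hp
  refine sobolevH10_induction (P := fun q => inner ℝ (component _ a hφ.toPair.2) q.1 =
    -inner ℝ hφ.toPair.1 (component _ a q.2)) (isClosed_eq (by fun_prop) (by fun_prop))
    (fun ψ hψ => ?_) hq
  rw [inner_eq_integral_mul (hφ.component_toPair_snd a) hψ.coeFn_toPair_fst,
    inner_eq_integral_mul hφ.coeFn_toPair_fst (hψ.component_toPair_snd a),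
    setIntegral_eq_integral_of_forall_compl_eq_zero fun x hx => by
      rw [hψ.eq_zero_of_notMem hx, mul_zero],
    setIntegral_eq_integral_of_forall_compl_eq_zero fun x hx => by
      rw [hφ.eq_zero_of_notMem hx, zero_mul]]
  exact hφ.integral_gradient_apply_mul hψ a

/-- The commutation relation `[∂_a, x_a] = 1` in weak form. -/
theorem norm_sq_fst_eq_neg_two_mul_inner (hb : Bornology.IsBounded Ω) (a : Fin d)
    (hp : p ∈ sobolevH10 Ω) :
    ‖p.1‖ ^ 2 = -2 * inner ℝ (component _ a p.2) (mulOp ℝ (coord hb a) p.1) := by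
  have hparts :=
    inner_component_eq_neg_inner_component hp (mulOp_coord_mem_sobolevH10 hb a hp) a
  simp only [map_add, component_mulOp, component_axisField, inner_add_right,
    real_inner_self_eq_norm_sq] at hparts
  rw [real_inner_comm _ p.1, inner_mulOp_left] at hparts
  linarith

theorem eq_zero_of_forall_inner_fst_eq_zero (ho : IsOpen Ω) {f : Lp ℝ 2 (volume.restrict Ω)}
    (hf : ∀ p ∈ sobolevH10 Ω, inner ℝ f p.1 = 0) : f = 0 := by
  have hloc : LocallyIntegrableOn f Ω :=
    locallyIntegrableOn_of_locallyIntegrable_restrict ((Lp.memLp f).locallyIntegrable (by norm_num))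
  have hae : ∀ᵐ x, x ∈ Ω → f x = 0 := by
    refine ho.ae_eq_zero_of_integral_contDiff_smul_eq_zero hloc fun φ hsmooth hcpt hsupp => ?_
    have hφ : IsTestFunction Ω φ := ⟨hsmooth, hcpt, hsupp⟩
    rw [← setIntegral_eq_integral_of_forall_compl_eq_zero fun x hx => by
      rw [hφ.eq_zero_of_notMem hx, zero_smul]]
    rw [← hf _ hφ.toPair_mem_sobolevH10, real_inner_comm,
      inner_eq_integral_mul hφ.coeFn_toPair_fst Filter.EventuallyEq.rfl]
    rfl
  exact (Lp.eq_zero_iff_ae_eq_zero).2 ((ae_restrict_iff' ho.measurableSet).2 hae)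

end Sobolev

section Wave

variable {E : Type*} [NormedAddCommGroup E] [InnerProductSpace ℝ E] [MeasurableSpace E]
  [OpensMeasurableSpace E] (μ : Measure E) [IsFiniteMeasure μ]

theorem memLp_cos_inner_sub (θ : ℝ) (ξ : E) :
    MemLp (fun x => Real.cos (2 * Real.pi * inner ℝ x ξ - θ)) 2 μ :=
  MemLp.of_bound (Continuous.aestronglyMeasurable (by fun_prop)) 1
    (ae_of_all _ fun _ => Real.abs_cos_le_one _)

/-- The real plane wave `x ↦ cos (2π⟪x, ξ⟫ - θ)` as an element of `L²(μ)`; the phases `θ = 0` and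
`θ = π / 2` give the cosine and the sine of frequency `ξ`. -/
def wave (θ : ℝ) (ξ : E) : Lp ℝ 2 μ :=
  (memLp_cos_inner_sub μ θ ξ).toLp

theorem coeFn_wave (θ : ℝ) (ξ : E) :
    wave μ θ ξ =ᵐ[μ] fun x => Real.cos (2 * Real.pi * inner ℝ x ξ - θ) :=
  (memLp_cos_inner_sub μ θ ξ).coeFn_toLp

theorem norm_sq_wave_sub (θ : ℝ) (ξ η : E) :
    ‖wave μ θ ξ - wave μ θ η‖ ^ 2 = ∫ x, (Real.cos (2 * Real.pi * inner ℝ x ξ - θ) -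
      Real.cos (2 * Real.pi * inner ℝ x η - θ)) ^ 2 ∂μ := by
  have hsub := (Lp.coeFn_sub (wave μ θ ξ) (wave μ θ η)).trans
    ((coeFn_wave μ θ ξ).sub (coeFn_wave μ θ η))
  rw [← real_inner_self_eq_norm_sq, inner_eq_integral_mul hsub hsub]
  simp only [Pi.sub_apply, sq]

theorem continuous_wave (θ : ℝ) : Continuous (wave μ θ) := by
  refine continuous_iff_continuousAt.2 fun ξ₀ => tendsto_iff_norm_sub_tendsto_zero.2 ?_
  have hcont : Continuous fun ξ => ∫ x, (Real.cos (2 * Real.pi * inner ℝ x ξ - θ) -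
      Real.cos (2 * Real.pi * inner ℝ x ξ₀ - θ)) ^ 2 ∂μ := by
    refine continuous_of_dominated (bound := fun _ => 2 ^ 2)
      (fun ξ => Continuous.aestronglyMeasurable (by fun_prop)) (fun ξ => ae_of_all _ fun x => ?_)
      (integrable_const _) (ae_of_all _ fun x => by fun_prop)
    rw [norm_pow]
    gcongr
    refine (norm_sub_le _ _).trans ?_
    linarith [Real.abs_cos_le_one (2 * Real.pi * inner ℝ x ξ - θ),
      Real.abs_cos_le_one (2 * Real.pi * inner ℝ x ξ₀ - θ),
      Real.norm_eq_abs (Real.cos (2 * Real.pi * inner ℝ x ξ - θ)),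
      Real.norm_eq_abs (Real.cos (2 * Real.pi * inner ℝ x ξ₀ - θ))]
  have hsqrt := (hcont.sqrt).tendsto ξ₀
  simpa only [← norm_sq_wave_sub, Real.sqrt_sq (norm_nonneg _), sub_self, norm_zero,
    zero_pow two_ne_zero, integral_zero, Real.sqrt_zero] using hsqrt

theorem norm_sq_wave_add (ξ : E) :
    ‖wave μ 0 ξ‖ ^ 2 + ‖wave μ (Real.pi / 2) ξ‖ ^ 2 = μ.real Set.univ := by
  rw [← real_inner_self_eq_norm_sq, ← real_inner_self_eq_norm_sq, L2.inner_def, L2.inner_def,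
    ← integral_add (L2.integrable_inner _ _) (L2.integrable_inner _ _)]
  trans ∫ _, (1 : ℝ) ∂μ
  · refine integral_congr_ae ?_
    filter_upwards [coeFn_wave μ 0 ξ, coeFn_wave μ (Real.pi / 2) ξ] with x hcos hsin
    rw [hcos, hsin, Real.cos_sub_pi_div_two]
    simp
  · simp

/-- The power spectrum `|û(ξ)|²` of `u ∈ L²(μ)`, where `û(ξ) = ∫ exp (-2πi⟪x, ξ⟫) u(x) dμ(x)`. -/
def fourierPower (u : Lp ℝ 2 μ) (ξ : E) : ℝ :=
  inner ℝ u (wave μ 0 ξ) ^ 2 + inner ℝ u (wave μ (Real.pi / 2) ξ) ^ 2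

theorem fourierPower_nonneg (u : Lp ℝ 2 μ) (ξ : E) : 0 ≤ fourierPower μ u ξ :=
  add_nonneg (sq_nonneg _) (sq_nonneg _)

theorem fourierPower_le (u : Lp ℝ 2 μ) (ξ : E) :
    fourierPower μ u ξ ≤ ‖u‖ ^ 2 * μ.real Set.univ := by
  have hcauchy : ∀ v : Lp ℝ 2 μ, inner ℝ u v ^ 2 ≤ ‖u‖ ^ 2 * ‖v‖ ^ 2 := fun v => by
    rw [← mul_pow, ← sq_abs (inner ℝ u v)]
    gcongr
    exact abs_real_inner_le_norm u v
  rw [← norm_sq_wave_add μ ξ, mul_add]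
  exact add_le_add (hcauchy _) (hcauchy _)

theorem continuous_fourierPower (u : Lp ℝ 2 μ) : Continuous (fourierPower μ u) := by
  have hwave := continuous_wave μ
  unfold fourierPower
  fun_prop

theorem sum_fourierPower_le {ι : Type*} {u : ι → Lp ℝ 2 μ} (hu : Orthonormal ℝ u) (s : Finset ι)
    (ξ : E) : ∑ i ∈ s, fourierPower μ (u i) ξ ≤ μ.real Set.univ := by
  have hbessel : ∀ v : Lp ℝ 2 μ, ∑ i ∈ s, inner ℝ (u i) v ^ 2 ≤ ‖v‖ ^ 2 := fun v => by
    simpa only [Real.norm_eq_abs, sq_abs] using hu.sum_inner_products_le v (s := s)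
  simp only [fourierPower]
  rw [Finset.sum_add_distrib, ← norm_sq_wave_add μ ξ]
  exact add_le_add (hbessel _) (hbessel _)

variable {ν : Measure E} {g : E → ℝ}

theorem integrable_mul_fourierPower (hg : Integrable g ν) (u : Lp ℝ 2 μ) :
    Integrable (fun ξ => g ξ * fourierPower μ u ξ) ν := by
  refine hg.mul_bdd (c := ‖u‖ ^ 2 * μ.real Set.univ)
    (continuous_fourierPower μ u).aestronglyMeasurable (ae_of_all _ fun ξ => ?_)
  rw [Real.norm_of_nonneg (fourierPower_nonneg μ u ξ)]
  exact fourierPower_le μ u ξ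

theorem continuous_integral_mul_fourierPower (hg : Integrable g ν) :
    Continuous fun u : Lp ℝ 2 μ => ∫ ξ, g ξ * fourierPower μ u ξ ∂ν := by
  refine continuous_iff_continuousAt.2 fun u₀ => continuousAt_of_dominated
    (bound := fun ξ => ‖g ξ‖ * ((‖u₀‖ + 1) ^ 2 * μ.real Set.univ))
    (Filter.Eventually.of_forall fun u => (integrable_mul_fourierPower μ hg u).1) ?_
    (hg.norm.mul_const _) (ae_of_all _ fun ξ => ?_)
  · filter_upwards [Metric.ball_mem_nhds u₀ one_pos] with u hu
    refine ae_of_all _ fun ξ => ?_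
    rw [norm_mul, Real.norm_of_nonneg (fourierPower_nonneg μ u ξ)]
    gcongr
    refine (fourierPower_le μ u ξ).trans ?_
    gcongr
    rw [mem_ball_iff_norm] at hu
    linarith [norm_le_norm_add_norm_sub' u u₀]
  · unfold fourierPower
    fun_prop

theorem exists_finite_forall_fourierPower_le {K : Set E} (hK : IsCompact K) {ε : ℝ} (hε : 0 < ε) :
    ∃ s : Set (Lp ℝ 2 μ), s.Finite ∧ ∀ u, (∀ y ∈ s, inner ℝ y u = 0) →
      ∀ ξ ∈ K, fourierPower μ u ξ ≤ ε * ‖u‖ ^ 2 := by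
  obtain ⟨s, hs, hsmall⟩ := exists_finite_forall_norm_inner_le_of_isCompact (𝕜 := ℝ)
    ((hK.image (continuous_wave μ 0)).union (hK.image (continuous_wave μ (Real.pi / 2))))
    (Real.sqrt_pos.2 (half_pos hε))
  have hsq : ∀ u, (∀ y ∈ s, inner ℝ y u = 0) → ∀ w ∈ wave μ 0 '' K ∪ wave μ (Real.pi / 2) '' K,
      inner ℝ u w ^ 2 ≤ ε / 2 * ‖u‖ ^ 2 := fun u hu w hw => by
    have hpow := pow_le_pow_left₀ (norm_nonneg _) (hsmall u hu w hw) 2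
    rwa [Real.norm_eq_abs, sq_abs, mul_pow, Real.sq_sqrt (half_pos hε).le, real_inner_comm] at hpow
  refine ⟨s, hs, fun u hu ξ hξ => ?_⟩
  have hcos := hsq u hu _ (.inl ⟨ξ, hξ, rfl⟩)
  have hsin := hsq u hu _ (.inr ⟨ξ, hξ, rfl⟩)
  unfold fourierPower
  linarith

end Wave

section Plancherel

open FourierTransform LineDeriv

variable {d : ℕ} {Ω : Set (EuclideanSpace ℝ (Fin d))} {φ : EuclideanSpace ℝ (Fin d) → ℝ}

theorem integrable_sq_norm_schwartz (f : SchwartzMap (EuclideanSpace ℝ (Fin d)) ℂ) :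
    Integrable fun ξ => ‖f ξ‖ ^ 2 :=
  (memLp_two_iff_integrable_sq_norm f.continuous.aestronglyMeasurable).1 (f.memLp 2)

namespace IsTestFunction

/-- A test function as a complex-valued Schwartz function. -/
def toSchwartz (hφ : IsTestFunction Ω φ) : SchwartzMap (EuclideanSpace ℝ (Fin d)) ℂ :=
  (hφ.2.1.comp_left Complex.ofReal_zero : HasCompactSupport (Complex.ofReal ∘ φ)).toSchwartzMap
    (Complex.ofRealCLM.contDiff.comp hφ.1)

theorem toSchwartz_apply (hφ : IsTestFunction Ω φ) (x : EuclideanSpace ℝ (Fin d)) :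
    hφ.toSchwartz x = φ x := rfl

theorem lineDeriv_toSchwartz_apply (hφ : IsTestFunction Ω φ) (a : Fin d)
    (x : EuclideanSpace ℝ (Fin d)) :
    (∂_{EuclideanSpace.single a (1 : ℝ)} hφ.toSchwartz) x = ((gradient φ x a : ℝ) : ℂ) := by
  have hderiv : HasFDerivAt (hφ.toSchwartz : EuclideanSpace ℝ (Fin d) → ℂ)
      (Complex.ofRealCLM.comp (fderiv ℝ φ x)) x :=
    Complex.ofRealCLM.hasFDerivAt.comp x (hφ.differentiable x).hasFDerivAt
  rw [SchwartzMap.lineDerivOp_apply_eq_fderiv, gradient_apply, hderiv.fderiv]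
  rfl

theorem integral_sq (hφ : IsTestFunction Ω φ) : ∫ x, φ x ^ 2 = ‖hφ.toPair.1‖ ^ 2 := by
  rw [← real_inner_self_eq_norm_sq,
    inner_eq_integral_mul hφ.coeFn_toPair_fst hφ.coeFn_toPair_fst,
    setIntegral_eq_integral_of_forall_compl_eq_zero fun x hx => by
      rw [hφ.eq_zero_of_notMem hx, mul_zero]]
  simp only [sq]

theorem integral_gradient_apply_sq (hφ : IsTestFunction Ω φ) (a : Fin d) :
    ∫ x, gradient φ x a ^ 2 = ‖component _ a hφ.toPair.2‖ ^ 2 := by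
  rw [← real_inner_self_eq_norm_sq,
    inner_eq_integral_mul (hφ.component_toPair_snd a) (hφ.component_toPair_snd a),
    setIntegral_eq_integral_of_forall_compl_eq_zero fun x hx => by
      rw [hφ.gradient_eq_zero_of_notMem hx, PiLp.zero_apply, mul_zero]]
  simp only [sq]

theorem integral_norm_sq_fourier (hφ : IsTestFunction Ω φ) :
    ∫ ξ, ‖𝓕 hφ.toSchwartz ξ‖ ^ 2 = ‖hφ.toPair.1‖ ^ 2 := by
  simp only [SchwartzMap.integral_norm_sq_fourier, toSchwartz_apply, Complex.norm_real,
    Real.norm_eq_abs, sq_abs, hφ.integral_sq]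

theorem integral_norm_sq_fourier_lineDeriv (hφ : IsTestFunction Ω φ) (a : Fin d) :
    ∫ ξ, ‖𝓕 (∂_{EuclideanSpace.single a (1 : ℝ)} hφ.toSchwartz) ξ‖ ^ 2 =
      ‖component _ a hφ.toPair.2‖ ^ 2 := by
  simp only [SchwartzMap.integral_norm_sq_fourier, lineDeriv_toSchwartz_apply, Complex.norm_real,
    Real.norm_eq_abs, sq_abs, hφ.integral_gradient_apply_sq]

theorem norm_sq_fourier_lineDeriv (hφ : IsTestFunction Ω φ) (a : Fin d)
    (ξ : EuclideanSpace ℝ (Fin d)) :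
    ‖𝓕 (∂_{EuclideanSpace.single a (1 : ℝ)} hφ.toSchwartz) ξ‖ ^ 2 =
      4 * Real.pi ^ 2 * ξ a ^ 2 * ‖𝓕 hφ.toSchwartz ξ‖ ^ 2 := by
  rw [SchwartzMap.fourier_lineDerivOp_eq, smul_apply,
    SchwartzMap.smulLeftCLM_apply_apply (by fun_prop), norm_smul, norm_smul,
    EuclideanSpace.inner_single_right]
  simp [mul_pow]
  ring

theorem laplaceSymbol_mul_norm_sq_fourier (hφ : IsTestFunction Ω φ)
    (ξ : EuclideanSpace ℝ (Fin d)) :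
    laplaceSymbol ξ * ‖𝓕 hφ.toSchwartz ξ‖ ^ 2 =
      ∑ a : Fin d, ‖𝓕 (∂_{EuclideanSpace.single a (1 : ℝ)} hφ.toSchwartz) ξ‖ ^ 2 := by
  simp_rw [norm_sq_fourier_lineDeriv, laplaceSymbol, EuclideanSpace.norm_sq_eq, Real.norm_eq_abs,
    sq_abs, ← Finset.sum_mul, ← Finset.mul_sum]

theorem integrable_laplaceSymbol_mul (hφ : IsTestFunction Ω φ) :
    Integrable fun ξ => laplaceSymbol ξ * ‖𝓕 hφ.toSchwartz ξ‖ ^ 2 := by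
  simp_rw [laplaceSymbol_mul_norm_sq_fourier]
  exact integrable_finsetSum _ fun a _ => integrable_sq_norm_schwartz _

theorem integral_laplaceSymbol_mul (hφ : IsTestFunction Ω φ) :
    ∫ ξ, laplaceSymbol ξ * ‖𝓕 hφ.toSchwartz ξ‖ ^ 2 = ‖hφ.toPair.2‖ ^ 2 := by
  simp_rw [laplaceSymbol_mul_norm_sq_fourier]
  rw [integral_finsetSum _ fun a _ => integrable_sq_norm_schwartz _,
    norm_sq_eq_sum_norm_sq_component]
  simp_rw [integral_norm_sq_fourier_lineDeriv]

variable [IsFiniteMeasure (volume.restrict Ω)]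

theorem inner_wave (hφ : IsTestFunction Ω φ) (θ : ℝ) (ξ : EuclideanSpace ℝ (Fin d)) :
    inner ℝ hφ.toPair.1 (wave _ θ ξ) = ∫ x, φ x * Real.cos (2 * Real.pi * inner ℝ x ξ - θ) := by
  rw [inner_eq_integral_mul hφ.coeFn_toPair_fst (coeFn_wave _ θ ξ),
    setIntegral_eq_integral_of_forall_compl_eq_zero fun x hx => by
      rw [hφ.eq_zero_of_notMem hx, zero_mul]]

theorem fourier_toSchwartz (hφ : IsTestFunction Ω φ) (ξ : EuclideanSpace ℝ (Fin d)) :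
    𝓕 hφ.toSchwartz ξ = inner ℝ hφ.toPair.1 (wave _ 0 ξ) -
      inner ℝ hφ.toPair.1 (wave _ (Real.pi / 2) ξ) * Complex.I := by
  have hint : ∀ θ : ℝ, Integrable fun x =>
      ((φ x * Real.cos (2 * Real.pi * inner ℝ x ξ - θ) : ℝ) : ℂ) := fun θ =>
    ((hφ.continuous.mul (by fun_prop)).integrable_of_hasCompactSupport hφ.2.1.mul_right).ofReal
  rw [SchwartzMap.fourier_coe, Real.fourier_eq', inner_wave, inner_wave, ← integral_complex_ofReal,
    ← integral_complex_ofReal, ← integral_mul_const,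
    ← integral_sub (hint 0) ((hint _).mul_const _)]
  refine integral_congr_ae (ae_of_all _ fun x => ?_)
  simp only [toSchwartz_apply, Complex.exp_mul_I, smul_eq_mul, sub_zero, Real.cos_sub_pi_div_two,
    ← Complex.ofReal_cos, ← Complex.ofReal_sin, neg_mul, Real.cos_neg, Real.sin_neg]
  push_cast
  ring

theorem fourierPower_toPair (hφ : IsTestFunction Ω φ) (ξ : EuclideanSpace ℝ (Fin d)) :
    fourierPower _ hφ.toPair.1 ξ = ‖𝓕 hφ.toSchwartz ξ‖ ^ 2 := by
  rw [fourier_toSchwartz, Complex.sq_norm, Complex.normSq_apply, fourierPower]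
  simp [sq]

end IsTestFunction

end Plancherel

section Eigenspace

variable {d : ℕ} {Ω : Set (EuclideanSpace ℝ (Fin d))} {μ : ℝ}

theorem mem_eigenspace_iff {u : Lp ℝ 2 (volume.restrict Ω)} :
    u ∈ eigenspace Ω μ ↔ ∃ g, IsFormEigenpair (sobolevH10 Ω) μ (u, g) := Iff.rfl

theorem orthogonalFamily_eigenspace (Ω : Set (EuclideanSpace ℝ (Fin d))) :
    OrthogonalFamily ℝ (fun μ => eigenspace Ω μ) fun μ => (eigenspace Ω μ).subtypeₗᵢ :=
  OrthogonalFamily.of_pairwise fun _ _ hμν => Submodule.isOrtho_iff_inner_eq.2 fun _ hu _ hv => by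
    obtain ⟨_, hp⟩ := mem_eigenspace_iff.1 hu
    obtain ⟨_, hq⟩ := mem_eigenspace_iff.1 hv
    exact hp.inner_fst_eq_zero hq hμν

theorem eigenspace_eq_bot (hd : 1 ≤ d) (hb : Bornology.IsBounded Ω) (hμ : μ ≤ 0) :
    eigenspace Ω μ = ⊥ := by
  refine (Submodule.eq_bot_iff _).2 fun u hu => ?_
  obtain ⟨g, hg⟩ := mem_eigenspace_iff.1 hu
  have hg₀ : g = 0 := by
    have hnorm : ‖g‖ ^ 2 ≤ 0 :=
      hg.norm_sq_snd.trans_le (mul_nonpos_of_nonpos_of_nonneg hμ (sq_nonneg _))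
    simpa using hnorm.antisymm (sq_nonneg _)
  simpa [hg₀] using norm_sq_fst_eq_neg_two_mul_inner hb ⟨0, hd⟩ hg.1

end Eigenspace

section BerezinLiYau

open FourierTransform

variable {d : ℕ} {Ω : Set (EuclideanSpace ℝ (Fin d))} [IsFiniteMeasure (volume.restrict Ω)]
  {p : Lp ℝ 2 (volume.restrict Ω) × Lp (EuclideanSpace ℝ (Fin d)) 2 (volume.restrict Ω)}

/-- On test functions this is Plancherel's theorem; both sides are continuous in the `H¹` norm. -/
theorem mul_norm_sq_add_mul_norm_sq_le_integral {g : EuclideanSpace ℝ (Fin d) → ℝ} {A B : ℝ}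
    (hg : Integrable g) (hle : ∀ ξ, A + B * laplaceSymbol ξ ≤ g ξ) (hp : p ∈ sobolevH10 Ω) :
    A * ‖p.1‖ ^ 2 + B * ‖p.2‖ ^ 2 ≤ ∫ ξ, g ξ * fourierPower _ p.1 ξ := by
  refine sobolevH10_induction (P := fun p => A * ‖p.1‖ ^ 2 + B * ‖p.2‖ ^ 2 ≤
    ∫ ξ, g ξ * fourierPower _ p.1 ξ) (isClosed_le (by fun_prop)
      ((continuous_integral_mul_fourierPower _ hg).comp continuous_fst)) (fun φ hφ => ?_) hp
  have hpow := integrable_sq_norm_schwartz (𝓕 hφ.toSchwartz)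
  have hsymbol := hφ.integrable_laplaceSymbol_mul
  rw [← hφ.integral_norm_sq_fourier, ← hφ.integral_laplaceSymbol_mul, ← integral_const_mul,
    ← integral_const_mul, ← integral_add (hpow.const_mul _) (hsymbol.const_mul _)]
  refine integral_mono ((hpow.const_mul _).add (hsymbol.const_mul _))
    (integrable_mul_fourierPower _ hg _) fun ξ => ?_
  simp only [hφ.fourierPower_toPair, ← mul_assoc, ← add_mul]
  gcongr
  exact hle ξ

theorem rieszFun_laplaceSymbol_eq_zero {σ z : ℝ} (hσ : 0 < σ) {ξ : EuclideanSpace ℝ (Fin d)}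
    (hξ : ξ ∉ Metric.closedBall 0 √z) : rieszFun σ z (laplaceSymbol ξ) = 0 := by
  refine rieszFun_of_le hσ ?_
  have hz : z ≤ ‖ξ‖ ^ 2 := (Real.sqrt_le_left (norm_nonneg ξ)).1 (by simpa using hξ : √z < ‖ξ‖).le
  exact hz.trans (le_mul_of_one_le_left (sq_nonneg _) (by nlinarith [Real.pi_gt_three]))

theorem integrable_rieszFun_laplaceSymbol {σ : ℝ} (hσ : 0 < σ) (z : ℝ) :
    Integrable fun ξ : EuclideanSpace ℝ (Fin d) => rieszFun σ z (laplaceSymbol ξ) := by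
  have hcont : Continuous fun ξ : EuclideanSpace ℝ (Fin d) => laplaceSymbol ξ := by
    unfold laplaceSymbol
    fun_prop
  exact ((continuous_rieszFun hσ.le z).comp hcont).integrable_of_hasCompactSupport <|
    HasCompactSupport.intro (isCompact_closedBall 0 √z) fun _ => rieszFun_laplaceSymbol_eq_zero hσ

variable {σ z μ : ℝ}

theorem rieszFun_le_integral_of_mem_eigenspace (hσ : 1 ≤ σ) {u : Lp ℝ 2 (volume.restrict Ω)}
    (hu : u ∈ eigenspace Ω μ) (hnorm : ‖u‖ = 1) :
    rieszFun σ z μ ≤ ∫ ξ, rieszFun σ z (laplaceSymbol ξ) * fourierPower _ u ξ := by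
  obtain ⟨g, hg⟩ := mem_eigenspace_iff.1 hu
  rcases lt_or_ge μ z with hμ | hμ
  · have hbound := mul_norm_sq_add_mul_norm_sq_le_integral
      (A := rieszFun σ z μ + σ * (z - μ) ^ (σ - 1) * μ) (B := -(σ * (z - μ) ^ (σ - 1)))
      (integrable_rieszFun_laplaceSymbol (σ := σ) (by linarith) z)
      (fun ξ => by linarith [rieszFun_sub_mul_le hσ hμ (laplaceSymbol ξ)]) hg.1
    rw [hg.norm_sq_snd, hnorm] at hbound
    linarith
  · rw [rieszFun_of_le (by linarith) hμ]
    exact integral_nonneg fun ξ => mul_nonneg (rieszFun_nonneg _ _ _) (fourierPower_nonneg _ _ ξ)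

variable {ι : Type*} {u : ι → Lp ℝ 2 (volume.restrict Ω)} {e : ι → ℝ}

theorem sum_rieszFun_le_mul_integral (hσ : 1 ≤ σ) (hu : Orthonormal ℝ u)
    (he : ∀ i, u i ∈ eigenspace Ω (e i)) (s : Finset ι) :
    ∑ i ∈ s, rieszFun σ z (e i) ≤ volume.real Ω *
      ∫ ξ : EuclideanSpace ℝ (Fin d), rieszFun σ z (laplaceSymbol ξ) := by
  have hsymbol := integrable_rieszFun_laplaceSymbol (d := d) (σ := σ) (by linarith) z
  have hint : ∀ i ∈ s, Integrable fun ξ =>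
      rieszFun σ z (laplaceSymbol ξ) * fourierPower _ (u i) ξ :=
    fun i _ => integrable_mul_fourierPower _ hsymbol _
  calc ∑ i ∈ s, rieszFun σ z (e i)
      ≤ ∑ i ∈ s, ∫ ξ, rieszFun σ z (laplaceSymbol ξ) * fourierPower _ (u i) ξ :=
        Finset.sum_le_sum fun i _ =>
          rieszFun_le_integral_of_mem_eigenspace hσ (he i) (hu.norm_eq_one i)
    _ = ∫ ξ, ∑ i ∈ s, rieszFun σ z (laplaceSymbol ξ) * fourierPower _ (u i) ξ :=
        (integral_finsetSum _ hint).symm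
    _ ≤ ∫ ξ : EuclideanSpace ℝ (Fin d), volume.real Ω * rieszFun σ z (laplaceSymbol ξ) := by
        refine integral_mono (integrable_finsetSum _ hint) (hsymbol.const_mul _) fun ξ => ?_
        dsimp only
        rw [← Finset.mul_sum, mul_comm]
        refine mul_le_mul_of_nonneg_right ?_ (rieszFun_nonneg _ _ _)
        simpa using sum_fourierPower_le (volume.restrict Ω) hu s ξ
    _ = _ := integral_const_mul _ _

theorem sum_rieszFun_le (hd : 1 ≤ d) (hσ : 1 ≤ σ) (hz : 0 < z)
    (hu : Orthonormal ℝ u) (he : ∀ i, u i ∈ eigenspace Ω (e i)) (s : Finset ι) :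
    ∑ i ∈ s, rieszFun σ z (e i) ≤
      classicalConst σ d * volume.real Ω * z ^ (σ + (d : ℝ) / 2) := by
  refine (sum_rieszFun_le_mul_integral hσ hu he s).trans_eq ?_
  rw [integral_rieszFun_laplaceSymbol hd (by linarith) hz]
  ring

end BerezinLiYau

section Discreteness

variable {d : ℕ} {Ω : Set (EuclideanSpace ℝ (Fin d))} [IsFiniteMeasure (volume.restrict Ω)]

theorem isCoerciveModFinite_sobolevH10 : IsCoerciveModFinite (sobolevH10 Ω) := fun c => by
  set M : ℝ := ∫ ξ : EuclideanSpace ℝ (Fin d), rieszFun 1 (c + 1) (laplaceSymbol ξ)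
  have hM : 0 ≤ M := integral_nonneg fun ξ => rieszFun_nonneg _ _ _
  have hsymbol := integrable_rieszFun_laplaceSymbol (d := d) one_pos (c + 1)
  obtain ⟨s, hs, hsmall⟩ := exists_finite_forall_fourierPower_le (volume.restrict Ω)
    (isCompact_closedBall (0 : EuclideanSpace ℝ (Fin d)) √(c + 1))
    (inv_pos.2 (add_pos_of_nonneg_of_pos hM one_pos))
  refine ⟨s, hs, fun p hp horth => ?_⟩
  have hlow := mul_norm_sq_add_mul_norm_sq_le_integral (A := c + 1) (B := -1) hsymbol
    (fun ξ => by
      rw [rieszFun, Real.rpow_one]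
      linarith [le_max_right 0 (c + 1 - laplaceSymbol ξ)]) hp
  have hhigh : ∫ ξ, rieszFun 1 (c + 1) (laplaceSymbol ξ) * fourierPower _ p.1 ξ ≤
      M * ((M + 1)⁻¹ * ‖p.1‖ ^ 2) := by
    rw [← integral_mul_const]
    refine integral_mono (integrable_mul_fourierPower _ hsymbol _) (hsymbol.mul_const _)
      fun ξ => ?_
    by_cases hξ : ξ ∈ Metric.closedBall 0 √(c + 1)
    · exact mul_le_mul_of_nonneg_left (hsmall _ horth ξ hξ) (rieszFun_nonneg _ _ _)
    · simp [rieszFun_laplaceSymbol_eq_zero one_pos hξ]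
  have hratio : M * ((M + 1)⁻¹ * ‖p.1‖ ^ 2) ≤ ‖p.1‖ ^ 2 := by
    rw [← mul_assoc, ← div_eq_mul_inv]
    exact mul_le_of_le_one_left (sq_nonneg _) ((div_le_one (by linarith)).2 (by linarith))
  linarith

instance finiteDimensional_eigenspace (μ : ℝ) : FiniteDimensional ℝ (eigenspace Ω μ) :=
  isCoerciveModFinite_sobolevH10.finiteDimensional (c := μ) fun _ hu => by
    obtain ⟨g, hg⟩ := mem_eigenspace_iff.1 hu
    exact ⟨g, hg.1, hg.norm_sq_snd.le⟩

theorem orthogonal_iSup_eigenspace (ho : IsOpen Ω) : (⨆ μ, eigenspace Ω μ)ᗮ = ⊥ := by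
  have : CompleteSpace (graphSpace (sobolevH10 Ω)) :=
    completeSpace_graphSpace (Submodule.isClosed_topologicalClosure (testGraph Ω))
  refine (Submodule.eq_bot_iff _).2 fun f hf =>
    isCoerciveModFinite_sobolevH10.eq_zero_of_forall_isFormEigenpair
      (fun _ => eq_zero_of_forall_inner_fst_eq_zero ho) fun μ p hp =>
        hf _ (Submodule.mem_iSup_of_mem μ (mem_eigenspace_iff.2 ⟨p.2, hp⟩))

theorem exists_hilbertBasis_mem_eigenspace (ho : IsOpen Ω) {ι : Type*} {e : ι → ℝ}
    (he : ∀ μ, {i | e i = μ}.encard = Cardinal.toENat (Module.rank ℝ (eigenspace Ω μ))) :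
    ∃ b : HilbertBasis ι ℝ (Lp ℝ 2 (volume.restrict Ω)), ∀ i, b i ∈ eigenspace Ω (e i) :=
  exists_hilbertBasis_mem_of_encard_eq_rank (orthogonalFamily_eigenspace Ω)
    (orthogonal_iSup_eigenspace ho) he

variable {ι : Type*} {u : ι → Lp ℝ 2 (volume.restrict Ω)} {e : ι → ℝ}

theorem summable_rieszFun {σ : ℝ} (hσ : 1 ≤ σ) (z : ℝ) (hu : Orthonormal ℝ u)
    (he : ∀ i, u i ∈ eigenspace Ω (e i)) : Summable fun i => rieszFun σ z (e i) :=
  summable_of_sum_le (fun _ => rieszFun_nonneg _ _ _) (sum_rieszFun_le_mul_integral hσ hu he)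

theorem finite_setOf_le (hu : Orthonormal ℝ u) (he : ∀ i, u i ∈ eigenspace Ω (e i)) (z : ℝ) :
    {i | e i ≤ z}.Finite := by
  have hlim := (summable_rieszFun le_rfl (z + 1) hu he).tendsto_cofinite_zero
  refine Set.Finite.subset (hlim.eventually_lt_const one_pos) fun i (hi : e i ≤ z) => ?_
  rw [Set.mem_compl_iff, Set.mem_ofPred_eq, not_lt, rieszFun, Real.rpow_one]
  exact le_max_of_le_right (by linarith)

end Discreteness

section PositionOperators

variable {d : ℕ} {Ω : Set (EuclideanSpace ℝ (Fin d))} (hb : Bornology.IsBounded Ω)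

/-- The commutator identity `[-Δ, x_a] = -2 ∂_a` between eigenfunctions. -/
theorem sub_mul_inner_mulOp_coord (a : Fin d) {μ ν : ℝ}
    {p q : Lp ℝ 2 (volume.restrict Ω) × Lp (EuclideanSpace ℝ (Fin d)) 2 (volume.restrict Ω)}
    (hp : IsFormEigenpair (sobolevH10 Ω) μ p) (hq : IsFormEigenpair (sobolevH10 Ω) ν q) :
    (μ - ν) * inner ℝ p.1 (mulOp ℝ (coord hb a) q.1) = -2 * inner ℝ p.1 (component _ a q.2) := by
  have hpq := hp.2 _ (mulOp_coord_mem_sobolevH10 hb a hq.1)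
  have hqp := hq.2 _ (mulOp_coord_mem_sobolevH10 hb a hp.1)
  have hparts := inner_component_eq_neg_inner_component hp.1 hq.1 a
  rw [inner_add_right, inner_axisField_right] at hpq hqp
  rw [← inner_mulOp_left (coord hb a) q.1, ← inner_mulOp_left, real_inner_comm p.2,
    real_inner_comm p.1, real_inner_comm p.1] at hqp
  linarith

variable {ι : Type*} {e : ι → ℝ}

/-- The total squared matrix element `∑_a ⟨u_j, x_a u_k⟩²` of the position operators. -/
def dipole (u : ι → Lp ℝ 2 (volume.restrict Ω)) (j k : ι) : ℝ :=
  ∑ a, inner ℝ (u j) (mulOp ℝ (coord hb a) (u k)) ^ 2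

variable {b : HilbertBasis ι ℝ (Lp ℝ 2 (volume.restrict Ω))}
  (he : ∀ i, b i ∈ eigenspace Ω (e i))

include he

theorem hasSum_sub_mul_dipole (j : ι) : HasSum (fun k => (e k - e j) * dipole hb b k j) d := by
  choose g hg using fun i => mem_eigenspace_iff.1 (he i)
  have haxis : ∀ a : Fin d, HasSum
      (fun k => (e k - e j) * inner ℝ (b k) (mulOp ℝ (coord hb a) (b j)) ^ 2) 1 := fun a => by
    have hparseval := (b.hasSum_inner_mul_inner (component _ a (g j))
      (mulOp ℝ (coord hb a) (b j))).mul_left (-2)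
    rw [← norm_sq_fst_eq_neg_two_mul_inner hb a (hg j).1, b.orthonormal.norm_eq_one,
      one_pow] at hparseval
    refine (congrArg (HasSum · _) (funext fun k => ?_)).mpr hparseval
    rw [sq, ← mul_assoc, sub_mul_inner_mulOp_coord hb a (hg k) (hg j), real_inner_comm (b k),
      mul_assoc]
  simp_rw [dipole, Finset.mul_sum]
  simpa using hasSum_sum fun (a : Fin d) (_ : a ∈ Finset.univ) => haxis a

theorem hasSum_sub_sq_mul_dipole (j : ι) :
    HasSum (fun k => (e k - e j) ^ 2 * dipole hb b k j) (4 * e j) := by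
  choose g hg using fun i => mem_eigenspace_iff.1 (he i)
  have haxis : ∀ a : Fin d, HasSum
      (fun k => (e k - e j) ^ 2 * inner ℝ (b k) (mulOp ℝ (coord hb a) (b j)) ^ 2)
      (4 * ‖component _ a (g j)‖ ^ 2) := fun a => by
    rw [← real_inner_self_eq_norm_sq]
    have hparseval := (b.hasSum_inner_mul_inner (component _ a (g j))
      (component _ a (g j))).mul_left 4
    refine (congrArg (HasSum · _) (funext fun k => ?_)).mpr hparseval
    rw [← mul_pow, sub_mul_inner_mulOp_coord hb a (hg k) (hg j), real_inner_comm (b k)]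
    ring
  have hnorm : ∑ a, ‖component _ a (g j)‖ ^ 2 = e j := by
    rw [← norm_sq_eq_sum_norm_sq_component, (hg j).norm_sq_snd, b.orthonormal.norm_eq_one,
      one_pow, mul_one]
  simp_rw [dipole, Finset.mul_sum]
  have htotal := hasSum_sum fun (a : Fin d) (_ : a ∈ Finset.univ) => haxis a
  rwa [← Finset.mul_sum, hnorm] at htotal

theorem sumRules_dipole : SumRules e (dipole hb b) d where
  symm j k := Finset.sum_congr rfl fun a _ => by rw [← inner_mulOp_left, real_inner_comm]
  nonneg _ _ := Finset.sum_nonneg fun _ _ => sq_nonneg _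
  hasSum_sub_mul := hasSum_sub_mul_dipole hb he
  hasSum_sub_sq_mul := hasSum_sub_sq_mul_dipole hb he

end PositionOperators

section Spectrum

variable {d : ℕ} {Ω : Set (EuclideanSpace ℝ (Fin d))}

theorem isFiniteMeasure_restrict_of_isBounded (hb : Bornology.IsBounded Ω) :
    IsFiniteMeasure (volume.restrict Ω) :=
  isFiniteMeasure_restrict.2 hb.measure_lt_top.ne

theorem encard_setOf_sigma_fst_eq {κ : Type*} (n : κ → ℕ) (μ : κ) :
    {i : Σ μ, Fin (n μ) | i.1 = μ}.encard = n μ := by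
  have hrange : {i : Σ μ, Fin (n μ) | i.1 = μ} = Set.range (Sigma.mk μ) := by
    ext ⟨ν, i⟩
    simp [eq_comm]
  rw [hrange, ← Set.image_univ, sigma_mk_injective.encard_image, Set.encard_univ]
  simp

theorem infinite_of_hilbertBasis (hd : 1 ≤ d) (ho : IsOpen Ω) (hne : Ω.Nonempty)
    (hb : Bornology.IsBounded Ω) {ι : Type*} {e : ι → ℝ}
    {b : HilbertBasis ι ℝ (Lp ℝ 2 (volume.restrict Ω))} (he : ∀ i, b i ∈ eigenspace Ω (e i)) :
    Infinite ι := by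
  have := isFiniteMeasure_restrict_of_isBounded hb
  have : NeZero (volume.restrict Ω) :=
    ⟨Measure.restrict_eq_zero.not.2 (ho.measure_pos volume hne).ne'⟩
  have : Nonempty ι := by
    by_contra! hempty
    have := nontrivial_Lp (F := ℝ) (volume.restrict Ω) 2
    have := b.repr.injective.nontrivial
    exact not_subsingleton (lp (fun _ : ι => ℝ) 2) inferInstance
  exact (sumRules_dipole hb he).infinite (Nat.cast_ne_zero.2 (Nat.one_le_iff_ne_zero.1 hd))

theorem exists_isSpectrum (hd : 1 ≤ d) (ho : IsOpen Ω) (hne : Ω.Nonempty)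
    (hb : Bornology.IsBounded Ω) : ∃ lam : ℕ → ℝ, IsSpectrum Ω lam := by
  have := isFiniteMeasure_restrict_of_isBounded hb
  let ι := Σ μ : ℝ, Fin (Module.finrank ℝ (eigenspace Ω μ))
  have hrank : ∀ μ, {i : ι | i.1 = μ}.encard =
      Cardinal.toENat (Module.rank ℝ (eigenspace Ω μ)) := fun μ => by
    rw [encard_setOf_sigma_fst_eq, ← Module.finrank_eq_rank, Cardinal.toENat_nat]
  obtain ⟨b, he⟩ := exists_hilbertBasis_mem_eigenspace ho hrank
  have := infinite_of_hilbertBasis hd ho hne hb he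
  obtain ⟨f, hf⟩ := exists_equiv_nat_monotone_comp (finite_setOf_le b.orthonormal he)
  refine ⟨_, hf, fun μ => ?_⟩
  rw [← hrank μ, ← f.injective.encard_image]
  exact congrArg Set.encard (f.image_preimage {i : ι | i.1 = μ})

variable {lam : ℕ → ℝ} {σ y z : ℝ}

theorem rieszMean_eq_sum (hσ : 0 < σ) {J : Finset ℕ} (hJ : ∀ k, lam k < z → k ∈ J) :
    rieszMean lam σ z = ∑ k ∈ J, rieszFun σ z (lam k) :=
  tsum_eq_sum fun k hk => rieszFun_of_le hσ (not_lt.1 (mt (hJ k) hk))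

namespace IsSpectrum

theorem pos (h : IsSpectrum Ω lam) (hd : 1 ≤ d) (ho : IsOpen Ω) (hb : Bornology.IsBounded Ω)
    (k : ℕ) : 0 < lam k := by
  have := isFiniteMeasure_restrict_of_isBounded hb
  obtain ⟨b, he⟩ := exists_hilbertBasis_mem_eigenspace ho h.multiplicity
  by_contra! hk
  have hzero := he k
  rw [eigenspace_eq_bot hd hb hk, Submodule.mem_bot] at hzero
  exact b.orthonormal.ne_zero k hzero

theorem summable_rieszTerm [IsFiniteMeasure (volume.restrict Ω)] (h : IsSpectrum Ω lam)
    (ho : IsOpen Ω) (hσ : 1 ≤ σ) (z : ℝ) : Summable (rieszTerm lam σ z) := by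
  obtain ⟨b, he⟩ := exists_hilbertBasis_mem_eigenspace ho h.multiplicity
  exact summable_rieszFun hσ z b.orthonormal he

theorem rieszMean_le [IsFiniteMeasure (volume.restrict Ω)] (h : IsSpectrum Ω lam) (hd : 1 ≤ d)
    (ho : IsOpen Ω) (hσ : 1 ≤ σ) (hz : 0 < z) :
    rieszMean lam σ z ≤ classicalConst σ d * volume.real Ω * z ^ (σ + (d : ℝ) / 2) := by
  obtain ⟨b, he⟩ := exists_hilbertBasis_mem_eigenspace ho h.multiplicity
  exact (h.summable_rieszTerm ho hσ z).tsum_le_of_sum_le (sum_rieszFun_le hd hσ hz b.orthonormal he)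

theorem rieszMean_mul_div_rpow_le (h : IsSpectrum Ω lam) (ho : IsOpen Ω)
    (hb : Bornology.IsBounded Ω) (hσ : 2 ≤ σ) (hy : 0 < y) (hyz : y ≤ z) :
    rieszMean lam σ y * (z / y) ^ (σ + (d : ℝ) / 2) ≤ rieszMean lam σ z := by
  have := isFiniteMeasure_restrict_of_isBounded hb
  obtain ⟨b, he⟩ := exists_hilbertBasis_mem_eigenspace ho h.multiplicity
  have hfinite := finite_setOf_le b.orthonormal he z
  have hJ : ∀ k, lam k < z → k ∈ hfinite.toFinset := fun k hk => hfinite.mem_toFinset.2 hk.le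
  rw [rieszMean_eq_sum (by linarith) hJ,
    rieszMean_eq_sum (by linarith) fun k hk => hJ k (hk.trans_le hyz)]
  exact (sumRules_dipole hb he).sum_rieszFun_mul_div_rpow_le hσ hJ hy hyz

theorem sub_rpow_mul_div_rpow_le_rieszMean (h : IsSpectrum Ω lam) (ho : IsOpen Ω)
    (hb : Bornology.IsBounded Ω) (hσ : 2 ≤ σ) (hy : 0 < y) (hyz : y ≤ z) {k : ℕ}
    (hk : lam k ≤ y) : (y - lam k) ^ σ * (z / y) ^ (σ + (d : ℝ) / 2) ≤ rieszMean lam σ z := by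
  have := isFiniteMeasure_restrict_of_isBounded hb
  refine le_trans ?_ (h.rieszMean_mul_div_rpow_le ho hb hσ hy hyz)
  refine mul_le_mul_of_nonneg_right ?_ (Real.rpow_nonneg (div_nonneg (hy.le.trans hyz) hy.le) _)
  have hterm := (h.summable_rieszTerm ho (by linarith : 1 ≤ σ) y).le_tsum k fun j _ =>
    rieszFun_nonneg σ y (lam j)
  rwa [rieszTerm, max_eq_right (sub_nonneg.2 hk)] at hterm

/-- The level `y = (1 + c) * lam 0` with `c = 2 * σ / d` maximises `(y - lam 0) ^ σ *
(z / y) ^ (σ + d / 2)`. -/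
theorem le_rieszMean (h : IsSpectrum Ω lam) (hd : 1 ≤ d) (ho : IsOpen Ω)
    (hb : Bornology.IsBounded Ω) (hσ : 2 ≤ σ) (hz : (1 + 2 * σ / d) * lam 0 ≤ z) :
    (2 * σ / (d : ℝ)) ^ σ * lam 0 ^ (-((d : ℝ) / 2)) *
      (z / (1 + 2 * σ / (d : ℝ))) ^ (σ + (d : ℝ) / 2) ≤ rieszMean lam σ z := by
  have hpos := h.pos hd ho hb 0
  set c : ℝ := 2 * σ / d
  have hc : 0 ≤ c := by positivity
  have hz₀ : 0 < z := lt_of_lt_of_le (by positivity) hz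
  have hpow : lam 0 ^ (-((d : ℝ) / 2)) = lam 0 ^ σ / lam 0 ^ (σ + (d : ℝ) / 2) := by
    rw [← Real.rpow_sub hpos, sub_add_cancel_left]
  have hbound := h.sub_rpow_mul_div_rpow_le_rieszMean ho hb hσ (by positivity) hz (k := 0)
    (by nlinarith)
  rw [add_mul, one_mul, add_sub_cancel_left, Real.mul_rpow hc hpos.le, ← one_add_mul, ← div_div,
    Real.div_rpow (by positivity) hpos.le] at hbound
  rw [hpow]
  convert hbound using 1
  ring

end IsSpectrum

end Spectrum

end Dirichlet

end

theorem mainTheorem2 (d : ℕ) (hd : 1 ≤ d) (Ω : Set (EuclideanSpace ℝ (Fin d)))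
    (hopen : IsOpen Ω) (hne : Ω.Nonempty) (hbdd : Bornology.IsBounded Ω) :
    (∃ lam : ℕ → ℝ, Dirichlet.IsSpectrum Ω lam) ∧
    ∀ lam : ℕ → ℝ, Dirichlet.IsSpectrum Ω lam → 0 < lam 0 ∧
      ∀ σ z : ℝ, 2 ≤ σ → (1 + 2 * σ / (d : ℝ)) * lam 0 ≤ z →
        Summable (Dirichlet.rieszTerm lam σ z) ∧
        (2 * σ / (d : ℝ)) ^ σ * lam 0 ^ (-((d : ℝ) / 2)) *
            (z / (1 + 2 * σ / (d : ℝ))) ^ (σ + (d : ℝ) / 2)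
          ≤ Dirichlet.rieszMean lam σ z ∧
        Dirichlet.rieszMean lam σ z
          ≤ Dirichlet.classicalConst σ d * volume.real Ω * z ^ (σ + (d : ℝ) / 2) := by
  have := Dirichlet.isFiniteMeasure_restrict_of_isBounded hbdd
  refine ⟨Dirichlet.exists_isSpectrum hd hopen hne hbdd, fun lam hlam => ?_⟩
  have hpos : 0 < lam 0 := hlam.pos hd hopen hbdd 0
  refine ⟨hpos, fun σ z hσ hz => ?_⟩
  have hσ₁ : 1 ≤ σ := one_le_two.trans hσ
  have hz₀ : 0 < z := lt_of_lt_of_le (by positivity) hz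
  exact ⟨hlam.summable_rieszTerm hopen hσ₁ z, hlam.le_rieszMean hd hopen hbdd hσ hz,
    hlam.rieszMean_le hd hopen hσ₁ hz₀⟩
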